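/- Let $R$ be an integral domain (commutative, with unit) which is not a field and such that for every $m\in R^\times:=R\setminus\{0\}$ the principal ideal $(m)$ has finite index in $R$. Let $\mathfrak{A}[R]$ be the universal unital C*-algebra generated by isometries $s_m$ ($m\in R^\times$) and unitaries $u^n$ ($n\in R$) subject to the relations 1. $s_k s_m=s_{km}$, 2. $u^l u^n=u^{l+n}$, 3. $s_m u^n=u^{mn}s_m$, 4. $\sum_{n+(m)\in R/(m)}u^n e_m u^{-n}=1$, where $e_m=s_ms_m^*$ and the sum is taken over a complete system of representatives $n$ of the cosets of $(m)$ in $R$ (given 1.–3., the summands do not depend on the choice of representatives), for all $k,m\in R^\times$ and $l,n\in R$. That is, $\mathfrak{A}[R]$ is the completion of the free unital complex *-algebra on these symbols with respect to the seminorm that assigns to a *-polynomial the supremum of the norms of its images under all families in unital C*-algebras satisfying these relations. Then $\mathfrak{A}[R]$ is simple, i.e. $\mathfrak{A}[R]\neq 0$ and its only closed two-sided ideals are $0$ and $\mathfrak{A}[R]$, and purely infinite, i.e. $\mathfrak{A}[R]\not\cong\mathbb{C}$ and for every $0\neq x\in\mathfrak{A}[R]$ there are $a,b\in\mathfrak{A}[R]$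 with $axb=1$. -/

import Mathlib

universe u

open scoped nonZeroDivisors

noncomputable section

namespace AxbAlgebra

/-! ### The relations -/

/-- The defining relations, for a family `s` indexed by the nonzero elements of `R` and a family `v`
indexed by `R` (`v n` stands for `u^n`): the `s m` are isometries, the `v n` are unitaries, and
the four `ax+b` relations hold. In the last one, `T` is a complete system of representatives of
`R / (m)`, so that the sum is the sum over all cosets `n + (m)`. -/
structure Relations {R : Type*} [CommRing R] {B : Type*} [Ring B] [StarRing B]
    (s : R⁰ → B) (v : R → B) : Prop where
  isometry : ∀ m, star (s m) * s m = 1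
  unitary : ∀ n, v n ∈ unitary B
  s_mul : ∀ k m, s k * s m = s (k * m)
  v_add : ∀ l n, v l * v n = v (l + n)
  s_v : ∀ (m : R⁰) (n : R), s m * v n = v ((m : R) * n) * s m
  sum_cosets : ∀ (m : R⁰) (T : Finset R),
    Set.BijOn (Ideal.Quotient.mk (Ideal.span {(m : R)})) (T : Set R) Set.univ →
      ∑ n ∈ T, v n * (s m * star (s m)) * v (-n) = 1

/-! ### The free unital complex *-algebra on a set -/

/-- The free unital complex *-algebra on `X`: noncommutative polynomials in symbols `x` and `x^*`,
where `(x, false)` is the symbol `x` and `(x, true)` is the symbol `x^*`. -/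
def FreeStarAlgebra (X : Type u) : Type u := FreeAlgebra ℂ (X × Bool)

namespace FreeStarAlgebra

variable {X : Type u}

instance : Ring (FreeStarAlgebra X) := inferInstanceAs (Ring (FreeAlgebra ℂ (X × Bool)))

instance : Algebra ℂ (FreeStarAlgebra X) :=
  inferInstanceAs (Algebra ℂ (FreeAlgebra ℂ (X × Bool)))

/-- The symbols `x` and `x^*`. -/
def sym (x : X × Bool) : FreeStarAlgebra X := FreeAlgebra.ι ℂ x

/-- The generator `x`. -/
def gen (x : X) : FreeStarAlgebra X := sym (x, false)

theorem induction {motive : FreeStarAlgebra X → Prop}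
    (scalar : ∀ r : ℂ, motive (algebraMap ℂ (FreeStarAlgebra X) r)) (sym : ∀ x, motive (sym x))
    (mul : ∀ a b, motive a → motive b → motive (a * b))
    (add : ∀ a b, motive a → motive b → motive (a + b))
    (a : FreeStarAlgebra X) : motive a :=
  FreeAlgebra.induction ℂ (X × Bool) scalar sym mul add a

/-- The algebra homomorphism out of the free algebra given by the images of all symbols. -/
def liftSym {B : Type*} [Ring B] [Algebra ℂ B] (g : X × Bool → B) : FreeStarAlgebra X →ₐ[ℂ] B :=
  FreeAlgebra.lift ℂ g

@[simp]
theorem liftSym_sym {B : Type*} [Ring B] [Algebra ℂ B] (g : X × Bool → B) (x : X × Bool) :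
    liftSym g (sym x) = g x :=
  FreeAlgebra.lift_ι_apply g x

/-- The conjugate-linear anti-multiplicative map that exchanges the symbols `x` and `x^*`. -/
def conjRev : FreeStarAlgebra X →+* (FreeStarAlgebra X)ᵐᵒᵖ :=
  letI : Algebra ℂ (FreeStarAlgebra X)ᵐᵒᵖ :=
    Algebra.compHom (FreeStarAlgebra X)ᵐᵒᵖ (starRingEnd ℂ)
  (liftSym fun x : X × Bool => MulOpposite.op (sym (x.1, !x.2)) :
    FreeStarAlgebra X →ₐ[ℂ] (FreeStarAlgebra X)ᵐᵒᵖ).toRingHom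

theorem conjRev_sym (x : X × Bool) : conjRev (sym x) = MulOpposite.op (sym (x.1, !x.2)) :=
  letI : Algebra ℂ (FreeStarAlgebra X)ᵐᵒᵖ :=
    Algebra.compHom (FreeStarAlgebra X)ᵐᵒᵖ (starRingEnd ℂ)
  liftSym_sym _ x

theorem conjRev_algebraMap (r : ℂ) :
    conjRev (algebraMap ℂ (FreeStarAlgebra X) r) =
      MulOpposite.op (algebraMap ℂ (FreeStarAlgebra X) (star r)) :=
  letI : Algebra ℂ (FreeStarAlgebra X)ᵐᵒᵖ :=
    Algebra.compHom (FreeStarAlgebra X)ᵐᵒᵖ (starRingEnd ℂ)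
  AlgHom.commutes (liftSym fun x : X × Bool => MulOpposite.op (sym (x.1, !x.2)) :
    FreeStarAlgebra X →ₐ[ℂ] (FreeStarAlgebra X)ᵐᵒᵖ) r

instance : StarRing (FreeStarAlgebra X) where
  star a := (conjRev a).unop
  star_involutive a := by
    induction a using FreeStarAlgebra.induction with
    | scalar r => simp [conjRev_algebraMap]
    | sym x => simp [conjRev_sym]
    | mul a b ha hb => simp [ha, hb]
    | add a b ha hb => simp [ha, hb]
  star_mul a b := by simp
  star_add a b := by simp

theorem star_sym (x : X × Bool) : star (sym x) = sym (x.1, !x.2) := by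
  change (conjRev (sym x)).unop = _
  rw [conjRev_sym, MulOpposite.unop_op]

theorem star_algebraMap (r : ℂ) :
    star (algebraMap ℂ (FreeStarAlgebra X) r) = algebraMap ℂ (FreeStarAlgebra X) (star r) := by
  change (conjRev _).unop = _
  rw [conjRev_algebraMap, MulOpposite.unop_op]

instance : StarModule ℂ (FreeStarAlgebra X) where
  star_smul r a := by
    rw [Algebra.smul_def, star_mul, star_algebraMap, Algebra.smul_def, Algebra.commutes]

/-- The evaluation of noncommutative *-polynomials at a family `g` of elements of a *-algebra. -/
def eval {B : Type*} [Ring B] [StarRing B] [Algebra ℂ B] [StarModule ℂ B] (g : X → B) :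
    FreeStarAlgebra X →⋆ₐ[ℂ] B where
  __ := liftSym fun x : X × Bool => if x.2 then star (g x.1) else g x.1
  map_star' a := by
    change liftSym _ (star a) = star (liftSym _ a)
    induction a using FreeStarAlgebra.induction with
    | scalar r => rw [star_algebraMap, AlgHom.commutes, AlgHom.commutes, algebraMap_star_comm]
    | sym x => rcases x with ⟨x, _ | _⟩ <;> simp [star_sym]
    | mul a b ha hb => rw [star_mul, map_mul, ha, hb, map_mul, star_mul]
    | add a b ha hb => rw [star_add, map_add, ha, hb, map_add, star_add]

theorem eval_sym {B : Type*} [Ring B] [StarRing B] [Algebra ℂ B] [StarModule ℂ B] (g : X → B)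
    (x : X × Bool) : eval g (sym x) = if x.2 then star (g x.1) else g x.1 :=
  liftSym_sym _ x

@[simp]
theorem eval_gen {B : Type*} [Ring B] [StarRing B] [Algebra ℂ B] [StarModule ℂ B] (g : X → B)
    (x : X) : eval g (gen x) = g x := by
  simp [gen, eval_sym]

end FreeStarAlgebra

/-! ### The universal C*-seminorm -/

/-- The free *-algebra on the symbols `s_m`, `m` a nonzero element of `R`, and `u^n`, `n ∈ R`. -/
def StarPoly (R : Type u) [CommRing R] : Type u := FreeStarAlgebra (R⁰ ⊕ R)

namespace StarPoly

variable (R : Type u) [CommRing R]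

instance : Ring (StarPoly R) := inferInstanceAs (Ring (FreeStarAlgebra (R⁰ ⊕ R)))

instance : Algebra ℂ (StarPoly R) := inferInstanceAs (Algebra ℂ (FreeStarAlgebra (R⁰ ⊕ R)))

instance : StarRing (StarPoly R) := inferInstanceAs (StarRing (FreeStarAlgebra (R⁰ ⊕ R)))

instance : StarModule ℂ (StarPoly R) := inferInstanceAs (StarModule ℂ (FreeStarAlgebra (R⁰ ⊕ R)))

variable {R}

/-- Evaluation of *-polynomials at `s_m ↦ s m`, `u^n ↦ v n`. -/
def eval {B : Type*} [CStarAlgebra B] (s : R⁰ → B) (v : R → B) : StarPoly R →⋆ₐ[ℂ] B :=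
  FreeStarAlgebra.eval (Sum.elim s v)

/-- The norms of all images of `a` in representations of the relations in C*-algebras. Every
C*-algebra generated by a family satisfying the relations is isomorphic to one in the universe
of `R`, so the universe restriction does not matter. -/
def normSet (a : StarPoly R) : Set ℝ :=
  {r | ∃ (B : Type u) (_ : CStarAlgebra B) (s : R⁰ → B) (v : R → B),
    Relations s v ∧ r = ‖eval s v a‖}

/-- The universal C*-seminorm. -/
def univNorm (a : StarPoly R) : ℝ := sSup (normSet a)

theorem norm_one_le {B : Type*} [CStarAlgebra B] : ‖(1 : B)‖ ≤ 1 := by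
  rcases subsingleton_or_nontrivial B with h | h
  · rw [Subsingleton.elim (1 : B) 0, norm_zero]
    exact zero_le_one
  · exact CStarRing.norm_one.le

theorem norm_le_one_of_isometry {B : Type*} [CStarAlgebra B] {w : B} (h : star w * w = 1) :
    ‖w‖ ≤ 1 := by
  have h1 : ‖w‖ * ‖w‖ ≤ 1 := by
    rw [← CStarRing.norm_star_mul_self, h]
    exact norm_one_le
  nlinarith [norm_nonneg w]

theorem bddAbove_normSet (a : StarPoly R) : BddAbove (normSet a) := by
  suffices h : ∃ C : ℝ, ∀ (B : Type u) (_ : CStarAlgebra B) (s : R⁰ → B) (v : R → B),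
      Relations s v → ‖eval s v a‖ ≤ C by
    obtain ⟨C, hC⟩ := h
    refine ⟨C, ?_⟩
    rintro r ⟨B, _, s, v, h, rfl⟩
    exact hC B _ s v h
  induction a using FreeStarAlgebra.induction with
  | scalar r =>
    refine ⟨‖r‖, fun B _ s v _ => ?_⟩
    have : eval s v (algebraMap ℂ (StarPoly R) r) = algebraMap ℂ B r := AlgHomClass.commutes _ r
    erw [this]
    rw [Algebra.algebraMap_eq_smul_one]
    refine (norm_smul_le _ _).trans ?_
    exact mul_le_of_le_one_right (norm_nonneg _) norm_one_le
  | sym x =>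
    refine ⟨1, fun B _ s v h => ?_⟩
    have : eval s v (FreeStarAlgebra.sym x) =
        if x.2 then star (Sum.elim s v x.1) else Sum.elim s v x.1 := FreeStarAlgebra.eval_sym _ x
    rw [this]
    have h1 : ‖Sum.elim s v x.1‖ ≤ 1 := by
      rcases x.1 with m | n
      · exact norm_le_one_of_isometry (h.isometry m)
      · exact norm_le_one_of_isometry (Unitary.star_mul_self_of_mem (h.unitary n))
    split_ifs
    · rwa [norm_star]
    · exact h1
  | mul a b ha hb =>
    obtain ⟨C, hC⟩ := ha
    obtain ⟨D, hD⟩ := hb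
    refine ⟨C * D, fun B _ s v h => ?_⟩
    have : eval s v (a * b) = eval s v a * eval s v b := map_mul (eval s v) _ _
    erw [this]
    refine (norm_mul_le _ _).trans ?_
    exact mul_le_mul (hC B _ s v h) (hD B _ s v h) (norm_nonneg _)
      ((norm_nonneg _).trans (hC B _ s v h))
  | add a b ha hb =>
    obtain ⟨C, hC⟩ := ha
    obtain ⟨D, hD⟩ := hb
    refine ⟨C + D, fun B _ s v h => ?_⟩
    have : eval s v (a + b) = eval s v a + eval s v b := map_add (eval s v) _ _
    erw [this]
    exact (norm_add_le _ _).trans (add_le_add (hC B _ s v h) (hD B _ s v h))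

theorem norm_eval_le {B : Type u} [CStarAlgebra B] {s : R⁰ → B} {v : R → B}
    (h : Relations s v) (a : StarPoly R) : ‖eval s v a‖ ≤ univNorm a :=
  le_csSup (bddAbove_normSet a) ⟨B, _, s, v, h, rfl⟩

theorem univNorm_nonneg (a : StarPoly R) : 0 ≤ univNorm a := by
  refine Real.sSup_nonneg ?_
  rintro r ⟨B, _, s, v, -, rfl⟩
  exact norm_nonneg _

theorem univNorm_le {a : StarPoly R} {C : ℝ} (hC : 0 ≤ C)
    (h : ∀ (B : Type u) (_ : CStarAlgebra B) (s : R⁰ → B) (v : R → B),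
      Relations s v → ‖eval s v a‖ ≤ C) : univNorm a ≤ C := by
  refine Real.sSup_le ?_ hC
  rintro r ⟨B, _, s, v, hr, rfl⟩
  exact h B _ s v hr

variable (R) in
/-- The universal C*-seminorm as a ring seminorm. -/
def univSeminorm : RingSeminorm (StarPoly R) where
  toFun := univNorm
  map_zero' := le_antisymm (univNorm_le le_rfl fun B _ s v _ => by simp) (univNorm_nonneg _)
  add_le' a b := univNorm_le (add_nonneg (univNorm_nonneg a) (univNorm_nonneg b))
    fun B _ s v h => by
      rw [map_add]
      exact (norm_add_le _ _).trans (add_le_add (norm_eval_le h a) (norm_eval_le h b))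
  neg' a := by simp [univNorm, normSet]
  mul_le' a b := univNorm_le (mul_nonneg (univNorm_nonneg a) (univNorm_nonneg b))
    fun B _ s v h => by
      rw [map_mul]
      exact (norm_mul_le _ _).trans (mul_le_mul (norm_eval_le h a) (norm_eval_le h b)
        (norm_nonneg _) (univNorm_nonneg a))

instance : SeminormedRing (StarPoly R) := (univSeminorm R).toSeminormedRing

theorem norm_def (a : StarPoly R) : ‖a‖ = univNorm a := rfl

instance : NormedAlgebra ℂ (StarPoly R) where
  norm_smul_le r a := univNorm_le (mul_nonneg (norm_nonneg r) (univNorm_nonneg a))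
    fun B _ s v h => by
      rw [map_smul, norm_smul]
      exact mul_le_mul_of_nonneg_left (norm_eval_le h a) (norm_nonneg r)

instance : NormedStarGroup (StarPoly R) where
  norm_star_le a := univNorm_le (univNorm_nonneg a) fun B _ s v h => by
    rw [map_star, norm_star]
    exact norm_eval_le h a

theorem norm_mul_self_le (a : StarPoly R) : ‖a‖ * ‖a‖ ≤ ‖star a * a‖ := by
  have h : ‖a‖ ≤ √‖star a * a‖ := univNorm_le (Real.sqrt_nonneg _) fun B _ s v h => by
    refine Real.le_sqrt_of_sq_le ?_
    rw [sq, ← CStarRing.norm_star_mul_self, ← map_star, ← map_mul]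
    exact norm_eval_le h _
  calc ‖a‖ * ‖a‖ ≤ √‖star a * a‖ * √‖star a * a‖ :=
        mul_self_le_mul_self (norm_nonneg _) h
    _ = ‖star a * a‖ := Real.mul_self_sqrt (norm_nonneg _)

end StarPoly

end AxbAlgebra

/-! ### The universal C*-algebra -/

open UniformSpace AxbAlgebra

/-- `𝔄[R]`, the universal C*-algebra generated by isometries `s_m` and unitaries `u^n` subject to
the `ax+b` relations: the Hausdorff completion of the free *-algebra on these symbols in the
universal C*-seminorm. -/
def RingCStarAlgebra (R : Type u) [CommRing R] : Type u := Completion (StarPoly R)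

namespace RingCStarAlgebra

variable (R : Type u) [CommRing R]

instance : NormedRing (RingCStarAlgebra R) := inferInstanceAs (NormedRing (Completion (StarPoly R)))

instance : CompleteSpace (RingCStarAlgebra R) :=
  inferInstanceAs (CompleteSpace (Completion (StarPoly R)))

instance : Algebra ℂ (RingCStarAlgebra R) :=
  inferInstanceAs (Algebra ℂ (Completion (StarPoly R)))

instance : NormedAlgebra ℂ (RingCStarAlgebra R) where
  norm_smul_le r a := norm_smul_le (β := Completion (StarPoly R)) r a

variable {R}

/-- The canonical map from the free *-algebra. -/
def ofPoly (a : StarPoly R) : RingCStarAlgebra R := (a : Completion (StarPoly R))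

theorem induction {motive : RingCStarAlgebra R → Prop} (x : RingCStarAlgebra R)
    (closed : IsClosed {x | motive x}) (ofPoly : ∀ a : StarPoly R, motive (ofPoly a)) : motive x :=
  Completion.induction_on x closed ofPoly

theorem continuous_ofPoly : Continuous (ofPoly : StarPoly R → RingCStarAlgebra R) :=
  Completion.continuous_coe (StarPoly R)

theorem norm_ofPoly (a : StarPoly R) : ‖ofPoly a‖ = ‖a‖ := Completion.norm_coe a

theorem ofPoly_one : ofPoly (1 : StarPoly R) = 1 := rfl

theorem ofPoly_mul (a b : StarPoly R) : ofPoly (a * b) = ofPoly a * ofPoly b :=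
  Completion.coe_mul a b

theorem ofPoly_add (a b : StarPoly R) : ofPoly (a + b) = ofPoly a + ofPoly b :=
  Completion.coe_add a b

theorem ofPoly_smul (r : ℂ) (a : StarPoly R) : ofPoly (r • a) = r • ofPoly a :=
  Completion.coe_smul r a

theorem ofPoly_algebraMap (r : ℂ) :
    ofPoly (algebraMap ℂ (StarPoly R) r) = algebraMap ℂ (RingCStarAlgebra R) r := rfl

/-- The involution, extended by continuity. -/
def starFun (x : RingCStarAlgebra R) : RingCStarAlgebra R :=
  Completion.map (star : StarPoly R → StarPoly R) x

theorem starFun_ofPoly (a : StarPoly R) : starFun (ofPoly a) = ofPoly (star a) :=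
  Completion.map_coe star_isometry.uniformContinuous a

theorem continuous_starFun : Continuous (starFun : RingCStarAlgebra R → RingCStarAlgebra R) :=
  Completion.continuous_map

instance : StarRing (RingCStarAlgebra R) where
  star := starFun
  star_involutive x := by
    induction x using RingCStarAlgebra.induction with
    | closed => exact isClosed_eq (continuous_starFun.comp continuous_starFun) continuous_id
    | ofPoly a => rw [starFun_ofPoly, starFun_ofPoly, star_star]
  star_mul x y := by
    induction x using RingCStarAlgebra.induction with
    | closed =>
      exact isClosed_eq (continuous_starFun.comp (continuous_mul_const y))
        (continuous_const.mul continuous_starFun)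
    | ofPoly a =>
      induction y using RingCStarAlgebra.induction with
      | closed =>
        exact isClosed_eq (continuous_starFun.comp (continuous_const_mul _))
          (continuous_starFun.mul continuous_const)
      | ofPoly b =>
        rw [← ofPoly_mul, starFun_ofPoly, starFun_ofPoly, starFun_ofPoly, star_mul, ofPoly_mul]
  star_add x y := by
    induction x using RingCStarAlgebra.induction with
    | closed =>
      exact isClosed_eq (continuous_starFun.comp (continuous_add_const y))
        (continuous_starFun.add continuous_const)
    | ofPoly a =>
      induction y using RingCStarAlgebra.induction with
      | closed =>
        exact isClosed_eq (continuous_starFun.comp (continuous_const_add _))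
          (continuous_const.add continuous_starFun)
      | ofPoly b =>
        rw [← ofPoly_add, starFun_ofPoly, starFun_ofPoly, starFun_ofPoly, star_add, ofPoly_add]

theorem star_ofPoly (a : StarPoly R) : star (ofPoly a) = ofPoly (star a) := starFun_ofPoly a

instance : ContinuousStar (RingCStarAlgebra R) := ⟨continuous_starFun⟩

variable (R) in
instance : CStarAlgebra (RingCStarAlgebra R) where
  norm_mul_self_le x := by
    induction x using RingCStarAlgebra.induction with
    | closed =>
      exact isClosed_le (continuous_norm.mul continuous_norm)
        (continuous_norm.comp (continuous_star.mul continuous_id))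
    | ofPoly a =>
      rw [star_ofPoly, ← ofPoly_mul, norm_ofPoly, norm_ofPoly]
      exact StarPoly.norm_mul_self_le a
  star_smul r x := by
    induction x using RingCStarAlgebra.induction with
    | closed =>
      exact isClosed_eq (continuous_star.comp (continuous_const_smul r))
        ((continuous_const_smul (star r)).comp continuous_star)
    | ofPoly a => rw [← ofPoly_smul, star_ofPoly, star_ofPoly, star_smul, ofPoly_smul]

/-- The generating isometries `s_m`. -/
def s (m : R⁰) : RingCStarAlgebra R :=
  ofPoly (FreeStarAlgebra.gen (Sum.inl m) : FreeStarAlgebra (R⁰ ⊕ R))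

/-- The generating unitaries `u^n`. -/
def v (n : R) : RingCStarAlgebra R :=
  ofPoly (FreeStarAlgebra.gen (Sum.inr n) : FreeStarAlgebra (R⁰ ⊕ R))

/-- The canonical map from the free *-algebra as a *-homomorphism. -/
def ofPolyHom : StarPoly R →⋆ₐ[ℂ] RingCStarAlgebra R where
  toFun := ofPoly
  map_one' := rfl
  map_mul' := ofPoly_mul
  map_zero' := rfl
  map_add' := ofPoly_add
  commutes' := ofPoly_algebraMap
  map_star' a := (star_ofPoly a).symm

theorem ofPoly_eq_of_eval {a b : StarPoly R}
    (h : ∀ (B : Type u) (_ : CStarAlgebra B) (s : R⁰ → B) (v : R → B),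
      Relations s v → StarPoly.eval s v a = StarPoly.eval s v b) : ofPoly a = ofPoly b := by
  have h1 : ofPolyHom (a - b) = 0 := by
    refine norm_le_zero_iff.1 ?_
    change ‖ofPoly (a - b)‖ ≤ 0
    rw [norm_ofPoly]
    exact StarPoly.univNorm_le le_rfl fun B _ s v hr => by simp [h B _ s v hr]
  rw [map_sub, sub_eq_zero] at h1
  exact h1

theorem eval_gen_inl {B : Type*} [CStarAlgebra B] (s : R⁰ → B) (v : R → B) (m : R⁰) :
    StarPoly.eval s v (FreeStarAlgebra.gen (Sum.inl m) : FreeStarAlgebra (R⁰ ⊕ R)) = s m :=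
  FreeStarAlgebra.eval_gen _ _

theorem eval_gen_inr {B : Type*} [CStarAlgebra B] (s : R⁰ → B) (v : R → B) (n : R) :
    StarPoly.eval s v (FreeStarAlgebra.gen (Sum.inr n) : FreeStarAlgebra (R⁰ ⊕ R)) = v n :=
  FreeStarAlgebra.eval_gen _ _

/-- The generators satisfy the relations. -/
theorem relations : Relations (s : R⁰ → RingCStarAlgebra R) v := by
  have key : ∀ a b : StarPoly R, (∀ (B : Type u) (_ : CStarAlgebra B) (s : R⁰ → B) (v : R → B),
      Relations s v → StarPoly.eval s v a = StarPoly.eval s v b) → ofPolyHom a = ofPolyHom b :=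
    fun a b h => ofPoly_eq_of_eval h
  let S : R⁰ → StarPoly R := fun m => (FreeStarAlgebra.gen (Sum.inl m) : FreeStarAlgebra (R⁰ ⊕ R))
  let V : R → StarPoly R := fun n => (FreeStarAlgebra.gen (Sum.inr n) : FreeStarAlgebra (R⁰ ⊕ R))
  have hS : ∀ {B : Type u} [CStarAlgebra B] (s : R⁰ → B) (v : R → B) m,
      StarPoly.eval s v (S m) = s m := fun s v m => eval_gen_inl s v m
  have hV : ∀ {B : Type u} [CStarAlgebra B] (s : R⁰ → B) (v : R → B) n,
      StarPoly.eval s v (V n) = v n := fun s v n => eval_gen_inr s v n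
  have hs : ∀ m, (s m : RingCStarAlgebra R) = ofPolyHom (S m) := fun _ => rfl
  have hv : ∀ n, (v n : RingCStarAlgebra R) = ofPolyHom (V n) := fun _ => rfl
  refine ⟨fun m => ?_, fun n => Unitary.mem_iff.2 ⟨?_, ?_⟩, fun k m => ?_, fun l n => ?_,
    fun m n => ?_, fun m T hT => ?_⟩
  · rw [hs, ← map_star, ← map_mul, ← map_one ofPolyHom]
    exact key _ _ fun B _ s v h => by simp only [map_mul, map_star, map_one, hS, h.isometry]
  · rw [hv, ← map_star, ← map_mul, ← map_one ofPolyHom]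
    exact key _ _ fun B _ s v h => by
      simp only [map_mul, map_star, map_one, hV, Unitary.star_mul_self_of_mem (h.unitary n)]
  · rw [hv, ← map_star, ← map_mul, ← map_one ofPolyHom]
    exact key _ _ fun B _ s v h => by
      simp only [map_mul, map_star, map_one, hV, Unitary.mul_star_self_of_mem (h.unitary n)]
  · rw [hs, hs, hs, ← map_mul]
    exact key _ _ fun B _ s v h => by simp only [map_mul, hS, h.s_mul]
  · rw [hv, hv, hv, ← map_mul]
    exact key _ _ fun B _ s v h => by simp only [map_mul, hV, h.v_add]
  · rw [hs, hv, hv, ← map_mul, ← map_mul]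
    exact key _ _ fun B _ s v h => by simp only [map_mul, hS, hV, h.s_v]
  · simp only [hs, hv, ← map_mul, ← map_star, ← map_sum]
    rw [← map_one ofPolyHom]
    exact key _ _ fun B _ s v h => by
      simp only [map_sum, map_mul, map_star, map_one, hS, hV, h.sum_cosets m T hT]

/-- The universal property: every family that satisfies the relations in a unital C*-algebra is
the image of the generators under exactly one unital *-homomorphism. -/
theorem existsUnique_hom {B : Type u} [CStarAlgebra B] {s' : R⁰ → B} {v' : R → B}
    (h : Relations s' v') :
    ∃! φ : RingCStarAlgebra R →⋆ₐ[ℂ] B, (∀ m, φ (s m) = s' m) ∧ ∀ n, φ (v n) = v' n := by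
  have hcont : UniformContinuous (StarPoly.eval s' v') :=
    AddMonoidHomClass.uniformContinuous_of_bound (StarPoly.eval s' v') 1 fun a => by
      rw [one_mul]
      exact StarPoly.norm_eval_le h a
  obtain ⟨φ, hφc, hφ⟩ : ∃ φ : RingCStarAlgebra R → B, Continuous φ ∧
      ∀ a, φ (ofPoly a) = StarPoly.eval s' v' a :=
    ⟨Completion.extension (StarPoly.eval s' v'), Completion.continuous_extension,
      Completion.extension_coe hcont⟩
  refine ⟨{ toFun := φ, map_one' := ?_, map_mul' := ?_, map_zero' := ?_, map_add' := ?_,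
            commutes' := ?_, map_star' := ?_ }, ⟨?_, ?_⟩, ?_⟩
  · rw [← ofPoly_one, hφ, map_one]
  · intro x y
    induction x using RingCStarAlgebra.induction with
    | closed => exact isClosed_eq (hφc.comp (continuous_mul_const y)) (hφc.mul continuous_const)
    | ofPoly a =>
      induction y using RingCStarAlgebra.induction with
      | closed => exact isClosed_eq (hφc.comp (continuous_const_mul _)) (continuous_const.mul hφc)
      | ofPoly b => rw [← ofPoly_mul, hφ, hφ, hφ, map_mul]
  · exact (hφ 0).trans (map_zero _)
  · intro x y
    induction x using RingCStarAlgebra.induction with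
    | closed => exact isClosed_eq (hφc.comp (continuous_add_const y)) (hφc.add continuous_const)
    | ofPoly a =>
      induction y using RingCStarAlgebra.induction with
      | closed => exact isClosed_eq (hφc.comp (continuous_const_add _)) (continuous_const.add hφc)
      | ofPoly b => rw [← ofPoly_add, hφ, hφ, hφ, map_add]
  · intro r
    exact (hφ _).trans (AlgHomClass.commutes _ r)
  · intro x
    induction x using RingCStarAlgebra.induction with
    | closed => exact isClosed_eq (hφc.comp continuous_star) (continuous_star.comp hφc)
    | ofPoly a => rw [star_ofPoly, hφ, hφ, map_star]
  · exact fun m => (hφ _).trans (eval_gen_inl _ _ m)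
  · exact fun n => (hφ _).trans (eval_gen_inr _ _ n)
  · rintro ψ ⟨hψs, hψv⟩
    refine StarAlgHom.ext fun x => ?_
    change ψ x = φ x
    have hψc : Continuous ψ :=
      AddMonoidHomClass.continuous_of_bound ψ 1 fun x => by
        rw [one_mul]
        exact NonUnitalStarAlgHom.norm_apply_le ψ x
    refine induction (motive := fun x => ψ x = φ x) x (isClosed_eq hψc hφc) fun a => ?_
    rw [hφ]
    change ψ (ofPolyHom a) = _
    induction a using FreeStarAlgebra.induction with
    | scalar r =>
      exact (AlgHomClass.commutes (ψ.comp ofPolyHom) r).trans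
        (AlgHomClass.commutes (StarPoly.eval s' v') r).symm
    | sym x =>
      have hgen : ∀ y : R⁰ ⊕ R, ψ (ofPolyHom (FreeStarAlgebra.sym (y, false) : StarPoly R)) =
          Sum.elim s' v' y := by
        rintro (m | n)
        · exact hψs m
        · exact hψv n
      have he : StarPoly.eval s' v' (FreeStarAlgebra.sym x) =
        if x.2 then star (Sum.elim s' v' x.1) else Sum.elim s' v' x.1 :=
          FreeStarAlgebra.eval_sym _ x
      rw [he]
      rcases x with ⟨y, _ | _⟩
      · exact hgen y
      · have : (FreeStarAlgebra.sym (y, true) : StarPoly R) =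
            star (FreeStarAlgebra.sym (y, false) : StarPoly R) :=
          (FreeStarAlgebra.star_sym (y, false)).symm
        erw [this, map_star, map_star, hgen]
        rfl
    | mul a b ha hb =>
      exact (map_mul (ψ.comp ofPolyHom) a b).trans
        ((congrArg₂ (· * ·) ha hb).trans (map_mul (StarPoly.eval s' v') a b).symm)
    | add a b ha hb =>
      exact (map_add (ψ.comp ofPolyHom) a b).trans
        ((congrArg₂ (· + ·) ha hb).trans (map_add (StarPoly.eval s' v') a b).symm)

end RingCStarAlgebra

/-! ### Simple and purely infinite C*-algebras -/

/-- A C*-algebra is simple if it is nonzero and its only closed two-sided ideals are the trivial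
ones. -/
def IsSimpleCStarAlgebra (A : Type*) [CStarAlgebra A] : Prop :=
  Nontrivial A ∧ ∀ I : TwoSidedIdeal A, IsClosed (I : Set A) → I = ⊥ ∨ I = ⊤

/-- Pure infiniteness of a (simple) unital C*-algebra: for every `x ≠ 0` there are `a`, `b` with
`a x b = 1`. The algebra `ℂ`, which has this property, is not purely infinite by convention. -/
def IsPurelyInfiniteCStarAlgebra (A : Type*) [CStarAlgebra A] : Prop :=
  IsEmpty (A ≃⋆ₐ[ℂ] ℂ) ∧ ∀ x : A, x ≠ 0 → ∃ a b : A, a * x * b = 1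

end

/-! The monomials `mon`, that is `u^a s_k s_l^* u^{-b}`, implement affine bijections between cosets,
and their span is a dense *-subalgebra (`dense_monSpan`). In the regular representation on `ℓ²(R ×
G)`, `u^n` translates the first coordinate and `s_m` multiplies both coordinates, the second one
through `ι : R⁰ →* G`.

A nontrivial affine map fixes at most one point, `R` is infinite, and the ideals `(m)` separate
points. So, given finitely many monomials, some small coset is moved off itself by every nontrivial
one, and the isometry `w` onto that coset compresses each monomial to `0` or `1`
(`exists_isometry_compress`). For `z` in the span, `w^* z w` is then a scalar, and it can be made
any prescribed diagonal coefficient of the regular representation with `ι` injective. If `x^* x` has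
a diagonal coefficient `c > 0`, approximating `x^* x` by such a `z` makes `w^* x^* x w` invertible.
This gives `a x b = 1`, hence simplicity and pure infiniteness.

A nonzero coefficient exists because the regular representation is faithful. This rests on growth:
in a grading by a commutative monoid, `y ^ p` has only polynomially many components, so if each
component is controlled by the norm of the image, taking `p`-th roots removes all constants
(`norm_le_norm_map_of_graded`). The argument runs twice: for degree one, graded by translations in
`R`, and for the whole span, graded by the degree `k / l` in the units of the fraction field. -/

/-! ### Norm comparison by polynomial growth -/

section Growth

open scoped Pointwise

/-- Finite subsets of commutative monoids have polynomial growth. -/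
theorem Finset.card_pow_le_of_comm {G : Type*} [CommMonoid G] [DecidableEq G] (S : Finset G)
    (p : ℕ) : (S ^ p).card ≤ (p + 1) ^ S.card := by
  -- By commutativity a product of `p` elements of `S` depends only on the exponents, each of which
  -- is at most `p`.
  have h : S ^ p ⊆ (Fintype.piFinset fun _ : S => Finset.range (p + 1)).image
      fun f : S → ℕ => ∏ i : S, (i : G) ^ f i := by
    induction p with
    | zero =>
      intro x hx
      rw [pow_zero, Finset.mem_one] at hx
      exact Finset.mem_image.2 ⟨fun _ => 0, by simp, by simp [hx]⟩
    | succ p ih =>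
      intro x hx
      rw [pow_succ] at hx
      obtain ⟨y, hy, z, hz, rfl⟩ := Finset.mem_mul.1 hx
      obtain ⟨f, hf, rfl⟩ := Finset.mem_image.1 (ih hy)
      simp only [Fintype.mem_piFinset, Finset.mem_range] at hf
      refine Finset.mem_image.2 ⟨f + Pi.single ⟨z, hz⟩ 1, ?_, ?_⟩
      · simp only [Fintype.mem_piFinset, Finset.mem_range, Pi.add_apply]
        intro i
        have h1 : (Pi.single ⟨z, hz⟩ 1 : S → ℕ) i ≤ 1 := by
          rw [Pi.single_apply]; split_ifs <;> simp
        have := hf i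
        omega
      · simp only [Pi.add_apply, pow_add, Finset.prod_mul_distrib]
        congr 1
        rw [Finset.prod_eq_single ⟨z, hz⟩] <;> simp +contextual
  refine (Finset.card_le_card h).trans (Finset.card_image_le.trans ?_)
  simp

variable {A B : Type*} [CStarAlgebra A] [CStarAlgebra B]

/-- If the powers of a self-adjoint element are controlled by their images up to polynomial
factors, then so is the element itself, without any factor. -/
theorem IsSelfAdjoint.norm_le_of_norm_pow_le {y : A} (hy : IsSelfAdjoint y) {b C : ℝ} (hb : 0 ≤ b)
    (d : ℕ) (h : ∀ p : ℕ, p ≠ 0 → ‖y ^ p‖ ≤ C * (p + 1) ^ d * b ^ p) : ‖y‖ ≤ b := by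
  by_contra! hlt
  rcases hb.eq_or_lt with rfl | hb
  · have := h 1 one_ne_zero
    simp only [pow_one, mul_zero] at this
    exact absurd this (not_le.2 hlt)
  have hq : 1 < ‖y‖ / b := (one_lt_div hb).2 hlt
  -- Along powers of two the C*-identity gives `‖y ^ p‖ = ‖y‖ ^ p`. If `‖y‖ > b`, a polynomial would
  -- dominate a growing exponential.
  have h1 : ∀ k : ℕ, 1 ≤ C * (((2 ^ k : ℕ) : ℝ) + 1) ^ d / (‖y‖ / b) ^ (2 ^ k) := fun k => by
    have := h (2 ^ k) (by positivity)
    rw [hy.norm_pow_two_pow] at this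
    rw [le_div_iff₀ (by positivity), one_mul, div_pow, div_le_iff₀ (by positivity)]
    exact this
  have h2 : Filter.Tendsto (fun n : ℕ => C * ((n : ℝ) + 1) ^ d / (‖y‖ / b) ^ n) Filter.atTop
      (nhds 0) := by
    have h3 := (tendsto_pow_const_div_const_pow_of_one_lt d hq).comp (Filter.tendsto_add_atTop_nat 1)
    have h4 := h3.const_mul (C * (‖y‖ / b))
    rw [mul_zero] at h4
    refine h4.congr fun n => ?_
    simp only [Function.comp_apply, pow_succ, Nat.cast_add, Nat.cast_one]
    have : ‖y‖ ≠ 0 := (hb.trans hlt).ne'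
    field_simp
  have h5 : Filter.Tendsto (fun k : ℕ => 2 ^ k) Filter.atTop Filter.atTop :=
    tendsto_pow_atTop_atTop_of_one_lt one_lt_two
  exact absurd (ge_of_tendsto' (h2.comp h5) h1) (by norm_num)

/-- Let `V` be a family of subspaces graded by a commutative monoid. If the norms of the components
of an element are bounded by the norm of its image under `ρ`, then `ρ` does not decrease the norm
of self-adjoint elements. -/
theorem norm_le_norm_map_of_graded {G : Type*} [CommMonoid G] (ρ : A →⋆ₐ[ℂ] B)
    (V : G → Submodule ℂ A) (hV : ∀ g h, ∀ x ∈ V g, ∀ y ∈ V h, x * y ∈ V (g * h)) (C : ℝ)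
    (hC : ∀ (S : Finset G) (x : G → A), (∀ g, x g ∈ V g) → ∀ g ∈ S,
      ‖x g‖ ≤ C * ‖ρ (∑ g ∈ S, x g)‖)
    {y : A} (hy : IsSelfAdjoint y) (hmem : y ∈ ⨆ g, V g) : ‖y‖ ≤ ‖ρ y‖ := by
  classical
  obtain ⟨S, hS⟩ := Submodule.mem_iSup_iff_exists_finset.1 hmem
  set W : Finset G → Submodule ℂ A := fun S => ⨆ g ∈ S, V g with hW
  have hmul : ∀ S T, ∀ x ∈ W S, ∀ y ∈ W T, x * y ∈ W (S * T) := by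
    intro S T x hx y hy
    obtain ⟨a, rfl⟩ := (Submodule.mem_iSup_finset_iff_exists_sum _ _).1 hx
    obtain ⟨b, rfl⟩ := (Submodule.mem_iSup_finset_iff_exists_sum _ _).1 hy
    rw [Finset.sum_mul_sum]
    exact sum_mem fun g hg => sum_mem fun k hk =>
      Submodule.mem_iSup_of_mem (g * k) (Submodule.mem_iSup_of_mem (Finset.mul_mem_mul hg hk)
        (hV _ _ _ (a g).2 _ (b k).2))
  have hbound : ∀ S, ∀ x ∈ W S, ‖x‖ ≤ C * S.card * ‖ρ x‖ := by
    intro S x hx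
    obtain ⟨a, rfl⟩ := (Submodule.mem_iSup_finset_iff_exists_sum _ _).1 hx
    refine (norm_sum_le _ _).trans ((Finset.sum_le_card_nsmul _ _ _
      fun g hg => hC S (fun g => (a g : A)) (fun g => (a g).2) g hg).trans_eq ?_)
    rw [nsmul_eq_mul]; ring
  -- Exponent zero is excluded: `1` is not assumed to lie in `V 1`.
  have hpow : ∀ p, p ≠ 0 → y ^ p ∈ W (S ^ p) := by
    intro p hp
    induction p, Nat.one_le_iff_ne_zero.2 hp using Nat.le_induction with
    | base => simpa using hS
    | succ p hp' ih =>
      rw [pow_succ, pow_succ]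
      exact hmul _ _ _ (ih (by omega)) _ hS
  refine hy.norm_le_of_norm_pow_le (C := |C|) (norm_nonneg _) S.card fun p hp => ?_
  refine (hbound _ _ (hpow p hp)).trans ?_
  rw [map_pow]
  have h1 : ((S ^ p).card : ℝ) ≤ (p + 1) ^ S.card := by
    exact_mod_cast Finset.card_pow_le_of_comm S p
  have h2 : ‖ρ y ^ p‖ ≤ ‖ρ y‖ ^ p := norm_pow_le' _ (Nat.pos_of_ne_zero hp)
  gcongr
  exact le_abs_self C

/-- The C*-identity reduces norm comparison to self-adjoint elements, where the growth argument
applies. -/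
theorem norm_le_norm_map_of_star_mul_self (ρ : A →⋆ₐ[ℂ] B) {x : A}
    (h : ‖star x * x‖ ≤ ‖ρ (star x * x)‖) : ‖x‖ ≤ ‖ρ x‖ := by
  rw [map_mul, map_star, CStarRing.norm_star_mul_self, CStarRing.norm_star_mul_self] at h
  exact le_of_sq_le_sq (by rwa [sq, sq]) (norm_nonneg _)

end Growth

/-! ### Consequences of the relations -/

namespace AxbAlgebra

/-- A complete system of representatives of `R / (m)`. -/
theorem exists_representatives {R : Type*} [CommRing R] (m : R)
    (hfin : Finite (R ⧸ Ideal.span {m})) :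
    ∃ T : Finset R, Set.BijOn (Ideal.Quotient.mk (Ideal.span {m})) (T : Set R) Set.univ := by
  classical
  have := Fintype.ofFinite (R ⧸ Ideal.span {m})
  refine ⟨Finset.univ.image fun x : R ⧸ Ideal.span {m} => x.out, fun _ _ => Set.mem_univ _, ?_, ?_⟩
  · intro x hx y hy hxy
    simp only [Finset.coe_image, Finset.coe_univ, Set.image_univ, Set.mem_range] at hx hy
    obtain ⟨x, rfl⟩ := hx
    obtain ⟨y, rfl⟩ := hy
    have h : ∀ z : R ⧸ Ideal.span {m}, Ideal.Quotient.mk (Ideal.span {m}) z.out = z :=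
      fun z => Ideal.Quotient.mk_out z
    rw [h, h] at hxy
    rw [hxy]
  · intro x _
    exact ⟨x.out, by simp, Ideal.Quotient.mk_out x⟩

section Representatives

variable {R : Type*} [CommRing R] {m : R} {T : Finset R}

theorem exists_eq_add_mul_of_bijOn
    (hT : Set.BijOn (Ideal.Quotient.mk (Ideal.span {m})) (T : Set R) Set.univ) (n : R) :
    ∃ i ∈ T, ∃ q, n = i + m * q := by
  obtain ⟨i, hi, hin⟩ := hT.surjOn (Set.mem_univ (Ideal.Quotient.mk _ n))
  obtain ⟨q, hq⟩ := Ideal.mem_span_singleton.1 (Ideal.Quotient.eq.1 hin.symm)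
  exact ⟨i, hi, q, by rw [← hq]; ring⟩

theorem eq_of_dvd_sub_of_bijOn
    (hT : Set.BijOn (Ideal.Quotient.mk (Ideal.span {m})) (T : Set R) Set.univ) {i j : R}
    (hi : i ∈ T) (hj : j ∈ T) (h : m ∣ i - j) : i = j :=
  hT.injOn hi hj (Ideal.Quotient.eq.2 (Ideal.mem_span_singleton.2 h))

end Representatives

/-- The element `u^a s_k s_l^* u^{-b}`, which implements the affine bijection of the coset `b + (l)`
onto `a + (k)`. -/
def mon {R : Type*} [CommRing R] {B : Type*} [Ring B] [StarRing B] (s : R⁰ → B) (v : R → B)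
    (a : R) (k l : R⁰) (b : R) : B :=
  v a * s k * star (s l) * v (-b)

namespace Relations

variable {R : Type*} [CommRing R] {B : Type*} [CStarAlgebra B] {s : R⁰ → B} {v : R → B}

theorem v_zero (h : Relations s v) : v 0 = 1 := by
  have h1 : star (v 0) * (v 0 * v 0) = star (v 0) * v 0 := by rw [h.v_add, add_zero]
  rwa [← mul_assoc, Unitary.star_mul_self_of_mem (h.unitary 0), one_mul] at h1

theorem star_v (h : Relations s v) (n : R) : star (v n) = v (-n) := by
  have h1 : star (v n) * (v n * v (-n)) = star (v n) := by
    rw [h.v_add, add_neg_cancel, h.v_zero, mul_one]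
  rw [← h1, ← mul_assoc, Unitary.star_mul_self_of_mem (h.unitary n), one_mul]

theorem s_one (h : Relations s v) : s 1 = 1 := by
  have h1 : star (s 1) * (s 1 * s 1) = star (s 1) * s 1 := by rw [h.s_mul, one_mul]
  rwa [← mul_assoc, h.isometry, one_mul] at h1

theorem star_s_mul_v (h : Relations s v) (m : R⁰) (n : R) :
    star (s m) * v (m * n) = v n * star (s m) := by
  have h1 := congrArg star (h.s_v m (-n))
  rw [star_mul, star_mul, h.star_v, h.star_v, neg_neg, mul_neg, neg_neg] at h1
  exact h1.symm

theorem star_s_mul_star_s (h : Relations s v) (k l : R⁰) :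
    star (s k) * star (s l) = star (s (l * k)) := by
  rw [← h.s_mul, star_mul]

theorem star_s_v_s (h : Relations s v) (m : R⁰) (n : R) :
    star (s m) * v (m * n) * s m = v n := by
  rw [h.star_s_mul_v, mul_assoc, h.isometry, mul_one]

/-- Distinct translates of the range projection of `s m` are orthogonal. -/
theorem star_s_v_s_eq_zero (h : Relations s v) (m : R⁰)
    (hfin : Finite (R ⧸ Ideal.span {(m : R)})) {n : R} (hn : ¬ (m : R) ∣ n) :
    star (s m) * v n * s m = 0 := by
  classical
  obtain ⟨T, hT⟩ := exists_representatives (m : R) hfin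
  obtain ⟨i, hi, p, hp⟩ := exists_eq_add_mul_of_bijOn hT 0
  obtain ⟨j, hj, q, hq⟩ := exists_eq_add_mul_of_bijOn hT n
  have hij : j ≠ i := by
    rintro rfl
    exact hn ⟨q - p, by linear_combination hq - hp⟩
  -- Conjugating the coset relation by `u^i s_m` gives `∑ x_t x_t^* = 1`. The term at `i` is already
  -- `1`, so the other terms, being positive with sum zero, all vanish. Up to a factor `v (q - p)`,
  -- the element in question is `x j`.
  let x : R → B := fun t => star (s m) * v (t - i) * s m
  have hx : ∀ t, star (x t) = star (s m) * v (i - t) * s m := fun t => by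
    simp only [x, star_mul, star_star, h.star_v, neg_sub, mul_assoc]
  have hxi : x i = 1 := by simp only [x, sub_self, h.v_zero, mul_one, h.isometry]
  have hsum : ∑ t ∈ T, x t * star (x t) = 1 := by
    have h1 := congrArg (fun z => star (s m) * v (-i) * z * (v i * s m)) (h.sum_cosets m T hT)
    have h2 : star (s m) * v (-i) * (v i * s m) = 1 := by
      rw [mul_assoc, ← mul_assoc (v (-i)), h.v_add, neg_add_cancel, h.v_zero, one_mul, h.isometry]
    simp only [mul_one] at h1
    rw [h2, Finset.mul_sum, Finset.sum_mul] at h1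
    rw [← h1]
    refine Finset.sum_congr rfl fun t _ => ?_
    have h3 : v (t - i) = v (-i) * v t := by rw [h.v_add]; congr 1; ring
    have h4 : v (i - t) = v (-t) * v i := by rw [h.v_add]; congr 1; ring
    rw [hx, h4]
    simp only [x, h3, mul_assoc]
  have hrest : ∑ t ∈ T.erase i, x t * star (x t) = 0 := by
    rw [← Finset.add_sum_erase T _ hi, hxi, star_one, mul_one] at hsum
    simpa using hsum
  have hj0 : x j * star (x j) = 0 := by
    let _ := CStarAlgebra.spectralOrder B
    have _ := CStarAlgebra.spectralOrderedRing B
    exact (Finset.sum_eq_zero_iff_of_nonneg fun t _ => mul_star_self_nonneg (x t)).1 hrest j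
      (Finset.mem_erase.2 ⟨hij, hj⟩)
  have hj1 : x j = 0 := CStarRing.mul_star_self_eq_zero_iff _ |>.1 hj0
  have hn' : v n = v (j - i) * v (m * (q - p)) := by
    rw [h.v_add]; congr 1; linear_combination hq - hp
  rw [hn', mul_assoc, mul_assoc, ← h.s_v, ← mul_assoc, ← mul_assoc]
  change x j * _ = 0
  rw [hj1, zero_mul]

theorem star_mon (h : Relations s v) (a : R) (k l : R⁰) (b : R) :
    star (mon s v a k l b) = mon s v b l k a := by
  simp only [mon, star_mul, star_star, h.star_v, neg_neg, mul_assoc]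

/-- The refinement of `u^a s_k s_l^* u^{-b}` along the cosets of `(m)`. -/
theorem mon_eq_sum (h : Relations s v) (a : R) (k l : R⁰) (b : R) (m : R⁰) {T : Finset R}
    (hT : Set.BijOn (Ideal.Quotient.mk (Ideal.span {(m : R)})) (T : Set R) Set.univ) :
    mon s v a k l b = ∑ t ∈ T, mon s v (a + k * t) (k * m) (l * m) (b + l * t) := by
  have h1 : mon s v a k l b = v a * s k * 1 * (star (s l) * v (-b)) := by
    rw [mon, mul_one]; simp only [mul_assoc]
  rw [h1, ← h.sum_cosets m T hT, Finset.mul_sum, Finset.sum_mul]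
  refine Finset.sum_congr rfl fun t _ => ?_
  have h2 : v (-(b + l * t)) = v (l * -t) * v (-b) := by rw [h.v_add]; congr 1; ring
  rw [mon, h2, ← h.v_add, ← h.s_mul k m, ← h.star_s_mul_star_s m l]
  calc v a * s k * (v t * (s m * star (s m)) * v (-t)) * (star (s l) * v (-b))
      = v a * (s k * v t) * s m * star (s m) * (v (-t) * star (s l)) * v (-b) := by
        simp only [mul_assoc]
    _ = _ := by rw [h.s_v, ← h.star_s_mul_v]; simp only [mul_assoc]

/-- The product of two of the elements `u^a s_k s_l^* u^{-b}` in the span of such elements. -/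
theorem mon_mul_mon_mem (h : Relations s v)
    (hfin : ∀ m : R⁰, Finite (R ⧸ Ideal.span {(m : R)})) (a : R) (k l : R⁰) (b a' : R)
    (k' l' : R⁰) (b' : R) (V : Submodule ℂ B)
    (hV : ∀ c d, mon s v c (k * k') (l * l') d ∈ V) :
    mon s v a k l b * mon s v a' k' l' b' ∈ V := by
  obtain ⟨T, hT⟩ := exists_representatives (l : R) (hfin l)
  have h1 : mon s v a k l b * mon s v a' k' l' b' =
      v a * s k * star (s l) * v (-b + a') * s k' * 1 * (star (s l') * v (-b')) := by
    simp only [mon, mul_one, ← h.v_add, mul_assoc]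
  -- The coset sum for `l` is inserted to the right of `s k'`. In each summand `s l` commutes past
  -- `s k'` and meets `star (s l)`, which leaves either zero or a single monomial.
  rw [h1, ← h.sum_cosets l T hT, Finset.mul_sum, Finset.sum_mul]
  refine sum_mem fun t _ => ?_
  have h2 : v a * s k * star (s l) * v (-b + a') * s k' * (v t * (s l * star (s l)) * v (-t)) *
      (star (s l') * v (-b')) = v a * s k * (star (s l) * v (-b + a' + k' * t) * s l) *
        (s k' * star (s (l * l')) * v (-(b' + l' * t))) := by
    have h3 : v (-(b' + l' * t)) = v (l' * -t) * v (-b') := by rw [h.v_add]; congr 1; ring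
    have h4 : s l * s k' = s k' * s l := by rw [h.s_mul, h.s_mul, mul_comm]
    rw [h3, mul_comm l l', ← h.star_s_mul_star_s l l', ← h.v_add (-b + a')]
    calc _ = v a * s k * star (s l) * v (-b + a') * (s k' * v t) * s l * star (s l) *
          (v (-t) * star (s l')) * v (-b') := by simp only [mul_assoc]
      _ = v a * s k * star (s l) * v (-b + a') * v (k' * t) * (s k' * s l) * star (s l) *
          (star (s l') * v (l' * -t)) * v (-b') := by
            rw [h.s_v, ← h.star_s_mul_v]; simp only [mul_assoc]
      _ = _ := by rw [← h4]; simp only [mul_assoc]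
  rw [h2]
  by_cases hd : (l : R) ∣ -b + a' + k' * t
  · obtain ⟨q, hq⟩ := hd
    rw [hq, h.star_s_v_s]
    have h3 : v a * s k * v q * (s k' * star (s (l * l')) * v (-(b' + l' * t))) =
        mon s v (a + k * q) (k * k') (l * l') (b' + l' * t) := by
      rw [mon, ← h.v_add a, ← h.s_mul k k', mul_assoc (v a), h.s_v]
      simp only [mul_assoc]
    rw [h3]
    exact hV _ _
  · rw [h.star_s_v_s_eq_zero l (hfin l) hd]
    simp

end Relations
end AxbAlgebra

/-! ### The regular representation -/

namespace AxbAlgebra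

noncomputable section

open scoped Classical

variable {ι κ : Type*}

/-- The standard basis vectors of `ℓ²(ι)`. -/
def basisVec (i : ι) : lp (fun _ : ι => ℂ) 2 := lp.single 2 i (1 : ℂ)

theorem inner_basisVec (i j : ι) [Decidable (i = j)] :
    inner ℂ (basisVec i) (basisVec j) = if i = j then (1 : ℂ) else 0 := by
  rw [basisVec, basisVec, lp.inner_single_left, lp.single_apply, Pi.single_apply]
  simp

theorem norm_basisVec (i : ι) : ‖basisVec i‖ = 1 := by
  rw [basisVec, lp.norm_single (by norm_num)]
  simp

theorem orthonormal_basisVec : Orthonormal ℂ (basisVec : ι → lp (fun _ : ι => ℂ) 2) :=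
  orthonormal_iff_ite.2 fun i j => inner_basisVec i j

theorem ext_basisVec {E : Type*} [NormedAddCommGroup E] [NormedSpace ℂ E]
    {S T : lp (fun _ : ι => ℂ) 2 →L[ℂ] E} (h : ∀ i, S (basisVec i) = T (basisVec i)) : S = T := by
  refine lp.ext_continuousLinearMap (by norm_num) fun i => ?_
  ext
  exact h i

theorem ext_inner_basisVec {x y : lp (fun _ : ι => ℂ) 2}
    (h : ∀ i, inner ℂ (basisVec i) x = inner ℂ (basisVec i) y) : x = y := by
  ext i
  have := h i
  simpa [basisVec, lp.inner_single_left] using this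

/-- The isometry of `ℓ²` spaces that maps the basis vector at `i` to the one at `f i`. -/
def pushIsometry (f : ι → κ) (hf : Function.Injective f) :
    lp (fun _ : ι => ℂ) 2 →ₗᵢ[ℂ] lp (fun _ : κ => ℂ) 2 :=
  (orthonormal_basisVec.comp f hf).orthogonalFamily.linearIsometry

/-- `pushIsometry` as a continuous linear map. -/
def push (f : ι → κ) (hf : Function.Injective f) :
    lp (fun _ : ι => ℂ) 2 →L[ℂ] lp (fun _ : κ => ℂ) 2 :=
  (pushIsometry f hf).toContinuousLinearMap

@[simp]
theorem push_basisVec (f : ι → κ) (hf : Function.Injective f) (i : ι) :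
    push f hf (basisVec i) = basisVec (f i) := by
  change (orthonormal_basisVec.comp f hf).orthogonalFamily.linearIsometry (lp.single 2 i 1) = _
  rw [OrthogonalFamily.linearIsometry_apply_single]
  simp

theorem norm_push_le (f : ι → κ) (hf : Function.Injective f) : ‖push f hf‖ ≤ 1 :=
  (pushIsometry f hf).norm_toContinuousLinearMap_le

theorem adjoint_push_basisVec (f : ι → κ) (hf : Function.Injective f) (i : ι) :
    ContinuousLinearMap.adjoint (push f hf) (basisVec (f i)) = basisVec i := by
  refine ext_inner_basisVec fun j => ?_
  rw [ContinuousLinearMap.adjoint_inner_right, push_basisVec, inner_basisVec, inner_basisVec]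
  simp [hf.eq_iff]

theorem adjoint_push_basisVec_of_notMem (f : ι → κ) (hf : Function.Injective f) {j : κ}
    (hj : ∀ i, f i ≠ j) : ContinuousLinearMap.adjoint (push f hf) (basisVec j) = 0 := by
  refine ext_inner_basisVec fun i => ?_
  rw [ContinuousLinearMap.adjoint_inner_right, push_basisVec, inner_basisVec, if_neg (hj i),
    inner_zero_right]

theorem star_push_mul_push (f : ι → ι) (hf : Function.Injective f) :
    star (push f hf) * push f hf = 1 := by
  refine ext_basisVec fun i => ?_
  rw [ContinuousLinearMap.star_eq_adjoint, mul_apply_eq_comp, push_basisVec,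
    adjoint_push_basisVec, one_apply_eq_self]

section Regular

variable {R : Type*} [CommRing R] {G : Type*}

theorem injective_regular_v (n : R) : Function.Injective fun x : R × G => (n + x.1, x.2) := by
  rintro ⟨r, a⟩ ⟨r', a'⟩ h
  simpa using h

variable (G) in
/-- The unitaries of the regular representation on `ℓ²(R × G)`. -/
def regularV (n : R) : lp (fun _ : R × G => ℂ) 2 →L[ℂ] lp (fun _ : R × G => ℂ) 2 :=
  push _ (injective_regular_v n)

@[simp]
theorem regularV_basisVec (n r : R) (a : G) :
    regularV G n (basisVec (r, a)) = basisVec (n + r, a) :=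
  push_basisVec _ _ _

variable [IsDomain R] [CommGroup G] (ι : R⁰ →* G)

theorem injective_regular_s (m : R⁰) :
    Function.Injective fun x : R × G => ((m : R) * x.1, ι m * x.2) := by
  rintro ⟨r, a⟩ ⟨r', a'⟩ h
  simp only [Prod.mk.injEq, mul_right_inj] at h
  rw [mul_right_inj' (nonZeroDivisors.ne_zero m.2)] at h
  exact Prod.ext h.1 h.2

/-- The isometries of the regular representation on `ℓ²(R × G)`. -/
def regularS (m : R⁰) : lp (fun _ : R × G => ℂ) 2 →L[ℂ] lp (fun _ : R × G => ℂ) 2 :=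
  push _ (injective_regular_s ι m)

@[simp]
theorem regularS_basisVec (m : R⁰) (r : R) (a : G) :
    regularS ι m (basisVec (r, a)) = basisVec ((m : R) * r, ι m * a) :=
  push_basisVec _ _ _

theorem star_regularS_basisVec (m : R⁰) (r : R) (a : G) :
    star (regularS ι m) (basisVec ((m : R) * r, a)) = basisVec (r, (ι m)⁻¹ * a) := by
  have := adjoint_push_basisVec _ (injective_regular_s ι m) (r, (ι m)⁻¹ * a)
  rw [mul_inv_cancel_left] at this
  exact this

theorem star_regularS_basisVec_of_not_dvd (m : R⁰) {r : R} (a : G) (h : ¬ (m : R) ∣ r) :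
    star (regularS ι m) (basisVec (r, a)) = 0 := by
  refine adjoint_push_basisVec_of_notMem _ _ ?_
  rintro ⟨r', a'⟩ h'
  exact h ⟨r', (congrArg Prod.fst h').symm⟩

/-- In the coset relation, only the representative congruent to `r` modulo `m` contributes at the
basis vector `(r, a)`, and it returns that vector. The group `G` stays arbitrary because two cases
are needed: the trivial group, and the units of the fraction field. -/
theorem relations_regular : Relations (regularS ι) (regularV G : R → _) where
  isometry m := star_push_mul_push _ _
  unitary n := by
    have h1 : star (regularV G n) * regularV G n = 1 := star_push_mul_push _ _
    have h2 : regularV G n * regularV G (-n) = 1 := ext_basisVec fun ⟨r, a⟩ => by simp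
    have h3 : star (regularV G n) = regularV G (-n) := by
      rw [← mul_one (star (regularV G n)), ← h2, ← mul_assoc, h1, one_mul]
    exact Unitary.mem_iff.2 ⟨h1, h3 ▸ h2⟩
  s_mul k m := ext_basisVec fun ⟨r, a⟩ => by simp [mul_assoc]
  v_add l n := ext_basisVec fun ⟨r, a⟩ => by simp [add_assoc]
  s_v m n := ext_basisVec fun ⟨r, a⟩ => by simp [mul_add]
  sum_cosets m T hT := ext_basisVec fun ⟨r, a⟩ => by
    obtain ⟨i, hi, q, hq⟩ := exists_eq_add_mul_of_bijOn hT r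
    rw [sum_apply, Finset.sum_eq_single i]
    · simp [star_regularS_basisVec, hq]
    · intro j hj hji
      have h1 : ¬ (m : R) ∣ -j + r := fun h => hji (eq_of_dvd_sub_of_bijOn hT hj hi (by
        have h2 : j - i = m * q - (-j + r) := by rw [hq]; ring
        rw [h2]
        exact dvd_sub (dvd_mul_right _ _) h))
      simp [star_regularS_basisVec_of_not_dvd ι m a h1]
    · exact fun h => absurd hi h

theorem mon_regular_basisVec (a : R) (k l : R⁰) (b q : R) (x : G) :
    mon (regularS ι) (regularV G) a k l b (basisVec (b + l * q, x)) =
      basisVec (a + k * q, ι k * ((ι l)⁻¹ * x)) := by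
  simp [mon, star_regularS_basisVec]

theorem mon_regular_basisVec_of_not_dvd (a : R) (k l : R⁰) {b r : R} (x : G)
    (h : ¬ (l : R) ∣ r - b) :
    mon (regularS ι) (regularV G) a k l b (basisVec (r, x)) = 0 := by
  rw [sub_eq_neg_add] at h
  simp [mon, star_regularS_basisVec_of_not_dvd ι l x h]

end Regular

end

end AxbAlgebra

/-! ### Faithfulness of the regular representation -/

theorem Submodule.mul_mem_of_mem_span {A : Type*} [Ring A] [Algebra ℂ A] {S T : Set A}
    {W : Submodule ℂ A} (h : ∀ x ∈ S, ∀ y ∈ T, x * y ∈ W) {x y : A}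
    (hx : x ∈ Submodule.span ℂ S) (hy : y ∈ Submodule.span ℂ T) : x * y ∈ W := by
  have h1 : x * y ∈ Submodule.span ℂ S * Submodule.span ℂ T := Submodule.mul_mem_mul hx hy
  rw [Submodule.span_mul_span] at h1
  refine Submodule.span_le.2 ?_ h1
  rintro _ ⟨a, ha, b, hb, rfl⟩
  exact h a ha b hb

namespace AxbAlgebra

variable {R : Type*} [CommRing R] {A : Type*} [CStarAlgebra A] {s : R⁰ → A} {v : R → A}

/-! ### Degree one: matrix units over the cosets of `(k)` -/

namespace Relations

/-- For fixed `k` the monomials multiply like matrix units indexed by `R / (k)`, with translations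
as entries; the next lemma is the case of mismatched indices. -/
theorem mon_mul_mon_same (h : Relations s v) (a : R) (k : R⁰) (b q d : R) :
    mon s v a k k b * mon s v (b + k * q) k k d = mon s v (a + k * q) k k d := by
  have h1 : mon s v a k k b * mon s v (b + k * q) k k d =
      v a * s k * (star (s k) * v (-b + (b + k * q)) * s k) * (star (s k) * v (-d)) := by
    simp only [mon, ← h.v_add (-b), mul_assoc]
  rw [h1, neg_add_cancel_left, h.star_s_v_s, mul_assoc (v a), h.s_v, mon, ← h.v_add a]
  simp only [mul_assoc]

theorem mon_mul_mon_eq_zero (h : Relations s v) (k : R⁰)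
    (hfin : Finite (R ⧸ Ideal.span {(k : R)})) (a d : R) {b c : R} (hbc : ¬ (k : R) ∣ c - b) :
    mon s v a k k b * mon s v c k k d = 0 := by
  have h1 : mon s v a k k b * mon s v c k k d =
      v a * s k * (star (s k) * v (c - b) * s k) * (star (s k) * v (-d)) := by
    rw [sub_eq_neg_add, ← h.v_add]
    simp only [mon, mul_assoc]
  rw [h1, h.star_s_v_s_eq_zero k hfin hbc]
  simp

theorem norm_mon_le (h : Relations s v) (a : R) (k l : R⁰) (b : R) : ‖mon s v a k l b‖ ≤ 1 := by
  have hs : ∀ m, ‖s m‖ ≤ 1 := fun m => StarPoly.norm_le_one_of_isometry (h.isometry m)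
  have hv : ∀ n, ‖v n‖ ≤ 1 := fun n =>
    StarPoly.norm_le_one_of_isometry (Unitary.star_mul_self_of_mem (h.unitary n))
  refine (norm_mul_le _ _).trans (mul_le_one₀ ?_ (norm_nonneg _) (hv _))
  refine (norm_mul_le _ _).trans (mul_le_one₀ ?_ (norm_nonneg _) (by rw [norm_star]; exact hs _))
  exact (norm_mul_le _ _).trans (mul_le_one₀ (hv _) (norm_nonneg _) (hs _))

/-- Every element of the span of the `u^a e_k u^{-b}` can be written with a single `k`. -/
theorem exists_mem_span_mon_same (h : Relations s v)
    (hfin : ∀ m : R⁰, Finite (R ⧸ Ideal.span {(m : R)})) {y : A}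
    (hy : y ∈ Submodule.span ℂ {x | ∃ a k b, x = mon s v a k k b}) :
    ∃ k, y ∈ Submodule.span ℂ (Set.range fun p : R × R => mon s v p.1 k k p.2) := by
  -- Refining along cosets of `(m)` replaces `k` by `k * m`, so two summands can be brought to a
  -- common multiple.
  have hle : ∀ k m, Submodule.span ℂ (Set.range fun p : R × R => mon s v p.1 k k p.2) ≤
      Submodule.span ℂ (Set.range fun p : R × R => mon s v p.1 (k * m) (k * m) p.2) := by
    intro k m
    refine Submodule.span_le.2 ?_
    rintro _ ⟨⟨a, b⟩, rfl⟩
    obtain ⟨T, hT⟩ := exists_representatives (m : R) (hfin m)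
    change mon s v a k k b ∈ _
    rw [h.mon_eq_sum a k k b m hT]
    exact sum_mem fun t _ => Submodule.subset_span ⟨(a + k * t, b + k * t), rfl⟩
  induction hy using Submodule.span_induction with
  | mem x hx =>
    obtain ⟨a, k, b, rfl⟩ := hx
    exact ⟨k, Submodule.subset_span ⟨(a, b), rfl⟩⟩
  | zero => exact ⟨1, zero_mem _⟩
  | add x y _ _ hx hy =>
    obtain ⟨k, hk⟩ := hx
    obtain ⟨l, hl⟩ := hy
    exact ⟨k * l, add_mem (hle k l hk) (mul_comm l k ▸ hle l k hl)⟩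
  | smul c x _ hx =>
    obtain ⟨k, hk⟩ := hx
    exact ⟨k, Submodule.smul_mem _ c hk⟩

variable [IsDomain R] {G : Type*} [CommGroup G] {ι : R⁰ →* G}
  {ρ : A →⋆ₐ[ℂ] (lp (fun _ : R × G => ℂ) 2 →L[ℂ] lp (fun _ : R × G => ℂ) 2)}

open scoped Classical in
-- These inner products read off the individual coefficients of a combination of monomials with
-- fixed `k`, which bounds them by the norm of its image.
theorem inner_mon_same {k : R⁰} {T : Finset R}
    (hT : Set.BijOn (Ideal.Quotient.mk (Ideal.span {(k : R)})) (T : Set R) Set.univ)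
    (i j i' j' : T) (n n' : R) :
    inner ℂ (basisVec ((i : R) + k * n, (1 : G)))
      (mon (regularS ι) (regularV G) (i' + k * n') k k j' (basisVec ((j : R), (1 : G)))) =
      if n = n' ∧ i = i' ∧ j = j' then (1 : ℂ) else 0 := by
  by_cases hj : j = j'
  · subst hj
    have h1 := mon_regular_basisVec ι (i' + k * n') k k j 0 (1 : G)
    rw [mul_zero, add_zero, add_zero, mul_one, mul_inv_cancel] at h1
    rw [h1, inner_basisVec]
    refine if_congr ?_ rfl rfl
    rw [Prod.mk.injEq]
    constructor
    · rintro ⟨h2, -⟩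
      have h3 : i = i' := Subtype.ext (eq_of_dvd_sub_of_bijOn hT i.2 i'.2
        ⟨n' - n, by linear_combination h2⟩)
      subst h3
      rw [add_right_inj, mul_right_inj' (nonZeroDivisors.ne_zero k.2)] at h2
      exact ⟨h2, rfl, rfl⟩
    · rintro ⟨rfl, rfl, -⟩
      exact ⟨rfl, rfl⟩
  · have h1 : ¬ (k : R) ∣ (j : R) - j' := fun h =>
      hj (Subtype.ext (eq_of_dvd_sub_of_bijOn hT j.2 j'.2 h))
    rw [mon_regular_basisVec_of_not_dvd ι _ k k 1 h1, inner_zero_right, if_neg fun h => hj h.2.2]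

/-- The regular representation is isometric on self-adjoint elements of degree one. -/
theorem norm_le_of_mem_span_mon_same (h : Relations s v)
    (hfin : ∀ m : R⁰, Finite (R ⧸ Ideal.span {(m : R)}))
    (hρ : ∀ a k l b, ρ (mon s v a k l b) = mon (regularS ι) (regularV G) a k l b)
    {y : A} (hsa : IsSelfAdjoint y)
    (hy : y ∈ Submodule.span ℂ {x | ∃ a k b, x = mon s v a k k b}) : ‖y‖ ≤ ‖ρ y‖ := by
  classical
  obtain ⟨k, hk⟩ := h.exists_mem_span_mon_same hfin hy
  obtain ⟨T, hT⟩ := exists_representatives (k : R) (hfin k)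
  -- The grading is by the translation part `n`. Each component is a combination of `card (T × T)`
  -- monomials of norm at most one, which is the constant supplied below.
  let e : Multiplicative R → T × T → A := fun n p => mon s v (p.1 + k * n.toAdd) k k p.2
  refine norm_le_norm_map_of_graded ρ (fun n => Submodule.span ℂ (Set.range (e n))) ?_
    (Fintype.card (T × T)) ?_ hsa ?_
  · intro n n' x hx y hy
    refine Submodule.mul_mem_of_mem_span ?_ hx hy
    rintro _ ⟨⟨i, j⟩, rfl⟩ _ ⟨⟨i', j'⟩, rfl⟩
    by_cases hj : i' = j
    · subst hj
      refine Submodule.subset_span ⟨(i, j'), ?_⟩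
      simp only [e]
      rw [h.mon_mul_mon_same, toAdd_mul, mul_add, add_assoc]
    · have h1 : ¬ (k : R) ∣ (i' : R) + k * n'.toAdd - j := fun hd =>
        hj (Subtype.ext (eq_of_dvd_sub_of_bijOn hT i'.2 j.2 (by
          have h2 : (i' : R) - j = i' + k * n'.toAdd - j - k * n'.toAdd := by ring
          rw [h2]
          exact dvd_sub hd (dvd_mul_right _ _))))
      simp only [e]
      rw [h.mon_mul_mon_eq_zero k (hfin k) _ _ h1]
      exact zero_mem _
  · intro S x hx n hn
    choose c hc using fun n => (Submodule.mem_span_range_iff_exists_fun ℂ).1 (hx n)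
    have hcoef : ∀ i j, c n (i, j) = inner ℂ (basisVec ((i : R) + k * n.toAdd, (1 : G)))
        (ρ (∑ n ∈ S, x n) (basisVec ((j : R), (1 : G)))) := by
      intro i j
      simp only [← hc, map_sum, map_smul, e, hρ, sum_apply, smul_apply, inner_sum, inner_smul_right,
        inner_mon_same hT]
      rw [Finset.sum_eq_single n, Finset.sum_eq_single (i, j)]
      · simp
      · rintro ⟨i', j'⟩ - hne
        rw [if_neg, mul_zero]
        rintro ⟨-, rfl, rfl⟩
        exact hne rfl
      · simp
      · intro n' _ hne
        refine Finset.sum_eq_zero fun p _ => ?_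
        rw [if_neg, mul_zero]
        rintro ⟨h1, -⟩
        exact hne (Multiplicative.toAdd.injective h1.symm)
      · exact fun h1 => absurd hn h1
    have hle : ∀ p, ‖c n p‖ ≤ ‖ρ (∑ n ∈ S, x n)‖ := by
      rintro ⟨i, j⟩
      rw [hcoef]
      refine (norm_inner_le_norm _ _).trans ?_
      rw [norm_basisVec, one_mul]
      refine (ContinuousLinearMap.le_opNorm _ _).trans ?_
      rw [norm_basisVec, mul_one]
    rw [← hc n]
    refine (norm_sum_le _ _).trans ((Finset.sum_le_card_nsmul _ _ _ fun p _ => ?_).trans_eq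
      (by rw [nsmul_eq_mul, Finset.card_univ]))
    rw [norm_smul]
    exact (mul_le_of_le_one_right (norm_nonneg _) (h.norm_mon_le _ _ _ _)).trans (hle p)
  · refine Submodule.span_le.2 ?_ hk
    rintro _ ⟨⟨a, b⟩, rfl⟩
    obtain ⟨i, hi, p, rfl⟩ := exists_eq_add_mul_of_bijOn hT a
    obtain ⟨j, hj, q, rfl⟩ := exists_eq_add_mul_of_bijOn hT b
    refine Submodule.mem_iSup_of_mem (Multiplicative.ofAdd (p - q))
      (Submodule.subset_span ⟨(⟨i, hi⟩, ⟨j, hj⟩), ?_⟩)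
    -- Translations by multiples of `k` commute with `s k * star (s k)`, so `-k q` moves to the left
    -- and the total translation is `p - q`.
    have h1 : v (-(j + k * q)) = v (k * -q) * v (-j) := by rw [h.v_add]; congr 1; ring
    have h2 : v (i + k * (p - q)) = v (i + k * p) * v (k * -q) := by
      rw [h.v_add]; congr 1; ring
    simp only [e, mon, toAdd_ofAdd, h1, h2]
    rw [← mul_assoc _ (v (k * -q)), mul_assoc _ (star (s k)) (v (k * -q)), h.star_s_mul_v,
      mul_assoc (v (i + k * p)), ← h.s_v]
    simp only [mul_assoc]

end Relations

end AxbAlgebra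

/-! ### The grading by degree in `G` -/

namespace AxbAlgebra

variable {R : Type*} [CommRing R] {A : Type*} [CStarAlgebra A] {s : R⁰ → A} {v : R → A}
  {G : Type*} [CommGroup G]

/-- The span of the elements `u^a s_k s_l^* u^{-b}` of degree `k / l = g`. -/
noncomputable def degreeSpace (s : R⁰ → A) (v : R → A) (ι : R⁰ →* G) (g : G) : Submodule ℂ A :=
  Submodule.span ℂ {x | ∃ a k l b, ι k * (ι l)⁻¹ = g ∧ x = mon s v a k l b}

/-- The span of all elements `u^a s_k s_l^* u^{-b}`. -/
noncomputable def monSpan (s : R⁰ → A) (v : R → A) : Submodule ℂ A :=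
  Submodule.span ℂ {x | ∃ a k l b, x = mon s v a k l b}

namespace Relations

theorem mul_mem_degreeSpace (h : Relations s v)
    (hfin : ∀ m : R⁰, Finite (R ⧸ Ideal.span {(m : R)})) (ι : R⁰ →* G) {g g' : G} {x y : A}
    (hx : x ∈ degreeSpace s v ι g) (hy : y ∈ degreeSpace s v ι g') :
    x * y ∈ degreeSpace s v ι (g * g') := by
  refine Submodule.mul_mem_of_mem_span ?_ hx hy
  rintro _ ⟨a, k, l, b, rfl, rfl⟩ _ ⟨a', k', l', b', rfl, rfl⟩
  refine h.mon_mul_mon_mem hfin a k l b a' k' l' b' _ fun c d =>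
    Submodule.subset_span ⟨c, k * k', l * l', d, ?_, rfl⟩
  rw [map_mul, map_mul, mul_inv, mul_mul_mul_comm]

theorem mul_mem_monSpan (h : Relations s v)
    (hfin : ∀ m : R⁰, Finite (R ⧸ Ideal.span {(m : R)})) {x y : A}
    (hx : x ∈ monSpan s v) (hy : y ∈ monSpan s v) : x * y ∈ monSpan s v := by
  refine Submodule.mul_mem_of_mem_span ?_ hx hy
  rintro _ ⟨a, k, l, b, rfl⟩ _ ⟨a', k', l', b', rfl⟩
  exact h.mon_mul_mon_mem hfin a k l b a' k' l' b' _ fun c d =>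
    Submodule.subset_span ⟨c, k * k', l * l', d, rfl⟩

theorem star_mem_degreeSpace (h : Relations s v) (ι : R⁰ →* G) {g : G} {x : A}
    (hx : x ∈ degreeSpace s v ι g) : star x ∈ degreeSpace s v ι g⁻¹ := by
  induction hx using Submodule.span_induction with
  | mem x hx =>
    obtain ⟨a, k, l, b, rfl, rfl⟩ := hx
    exact Submodule.subset_span ⟨b, l, k, a, by simp, h.star_mon a k l b⟩
  | zero => simp
  | add x y _ _ hx hy => rw [star_add]; exact add_mem hx hy
  | smul c x _ hx => rw [star_smul]; exact Submodule.smul_mem _ _ hx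

theorem star_mem_monSpan (h : Relations s v) {x : A} (hx : x ∈ monSpan s v) :
    star x ∈ monSpan s v := by
  induction hx using Submodule.span_induction with
  | mem x hx =>
    obtain ⟨a, k, l, b, rfl⟩ := hx
    exact Submodule.subset_span ⟨b, l, k, a, h.star_mon a k l b⟩
  | zero => simp
  | add x y _ _ hx hy => rw [star_add]; exact add_mem hx hy
  | smul c x _ hx => rw [star_smul]; exact Submodule.smul_mem _ _ hx

theorem s_mem_monSpan (h : Relations s v) (m : R⁰) : s m ∈ monSpan s v :=
  Submodule.subset_span ⟨0, m, 1, 0, by simp [mon, h.v_zero, h.s_one]⟩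

theorem v_mem_monSpan (h : Relations s v) (n : R) : v n ∈ monSpan s v :=
  Submodule.subset_span ⟨n, 1, 1, 0, by simp [mon, h.v_zero, h.s_one]⟩

theorem one_mem_monSpan (h : Relations s v) : 1 ∈ monSpan s v := by
  rw [← h.s_one]
  exact h.s_mem_monSpan 1

end Relations

theorem monSpan_le_iSup_degreeSpace (s : R⁰ → A) (v : R → A) (ι : R⁰ →* G) :
    monSpan s v ≤ ⨆ g, degreeSpace s v ι g := by
  refine Submodule.span_le.2 ?_
  rintro _ ⟨a, k, l, b, rfl⟩
  exact Submodule.mem_iSup_of_mem _ (Submodule.subset_span ⟨a, k, l, b, rfl, rfl⟩)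

/-! ### Compression to the unit fibre -/

section Compression

variable [IsDomain R] {ι : R⁰ →* G}

theorem injective_unitFibre {R G : Type*} [One G] :
    Function.Injective fun x : R × PUnit.{u + 1} => (x.1, (1 : G)) := by
  rintro ⟨r, _⟩ ⟨r', _⟩ h
  simpa using h

variable {ρ : A →⋆ₐ[ℂ] (lp (fun _ : R × G => ℂ) 2 →L[ℂ] lp (fun _ : R × G => ℂ) 2)}
  {ρ₁ : A →⋆ₐ[ℂ] (lp (fun _ : R × PUnit.{u + 1} => ℂ) 2 →L[ℂ]
    lp (fun _ : R × PUnit.{u + 1} => ℂ) 2)}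

/-- The compression of operators on `ℓ²(R × G)` to `ℓ²(R)`, embedded as the fibre over `1`. -/
noncomputable def compress {R : Type*}
    (ρ : A →⋆ₐ[ℂ] (lp (fun _ : R × G => ℂ) 2 →L[ℂ] lp (fun _ : R × G => ℂ) 2)) :
    A →ₗ[ℂ] (lp (fun _ : R × PUnit.{u + 1} => ℂ) 2 →L[ℂ]
      lp (fun _ : R × PUnit.{u + 1} => ℂ) 2) where
  toFun x := ContinuousLinearMap.adjoint (push _ injective_unitFibre) ∘L ρ x ∘L
    push _ injective_unitFibre
  map_add' x y := by ext1 z; simp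
  map_smul' c x := by ext1 z; simp

/-- The asymmetric bound, with `‖x‖` upstairs and `‖ρ y‖` in the image, later allows one factor `‖x
g‖` to be cancelled. -/
theorem norm_compress_mul_le {R : Type*}
    {ρ : A →⋆ₐ[ℂ] (lp (fun _ : R × G => ℂ) 2 →L[ℂ] lp (fun _ : R × G => ℂ) 2)} (x y : A) :
    ‖compress.{u} ρ (x * y)‖ ≤ ‖x‖ * ‖ρ y‖ := by
  have hJ := norm_push_le _ (injective_unitFibre.{u} (R := R) (G := G))
  refine (ContinuousLinearMap.opNorm_comp_le _ _).trans ?_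
  rw [LinearIsometryEquiv.norm_map]
  refine (mul_le_of_le_one_left (norm_nonneg _) hJ).trans ?_
  refine (ContinuousLinearMap.opNorm_comp_le _ _).trans ?_
  refine (mul_le_of_le_one_right (norm_nonneg _) hJ).trans ?_
  rw [map_mul]
  exact (norm_mul_le _ _).trans (mul_le_mul_of_nonneg_right
    (NonUnitalStarAlgHom.norm_apply_le ρ x) (norm_nonneg _))

/-- Degree `g ≠ 1` maps the unit fibre into the fibre over `g`, which is orthogonal to it. -/
theorem compress_eq_zero
    (hρ : ∀ a k l b, ρ (mon s v a k l b) = mon (regularS ι) (regularV G) a k l b) {g : G}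
    (hg : g ≠ 1) {x : A} (hx : x ∈ degreeSpace s v ι g) : compress.{u} ρ x = 0 := by
  suffices h : degreeSpace s v ι g ≤ LinearMap.ker (compress.{u} ρ) from h hx
  refine Submodule.span_le.2 ?_
  rintro _ ⟨a, k, l, b, rfl, rfl⟩
  refine ext_basisVec fun ⟨r, _⟩ => ?_
  change ContinuousLinearMap.adjoint (push _ injective_unitFibre)
    (ρ (mon s v a k l b) (push _ injective_unitFibre _)) = 0
  rw [push_basisVec, hρ]
  by_cases hd : (l : R) ∣ r - b
  · obtain ⟨q, hq⟩ := hd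
    obtain rfl : r = b + l * q := by rw [← hq]; ring
    rw [mon_regular_basisVec]
    refine adjoint_push_basisVec_of_notMem _ _ ?_
    rintro ⟨r', _⟩ h
    rw [Prod.mk.injEq, mul_one] at h
    exact hg h.2.symm
  · rw [mon_regular_basisVec_of_not_dvd ι a k l 1 hd, map_zero]

/-- Injectivity of `ι` forces `k = l` in degree one, and such monomials preserve the unit fibre,
acting there as on `ℓ²(R)`. -/
theorem compress_eq (hι : Function.Injective ι)
    (hρ : ∀ a k l b, ρ (mon s v a k l b) = mon (regularS ι) (regularV G) a k l b)
    (hρ₁ : ∀ a k l b, ρ₁ (mon s v a k l b) = mon (regularS 1) (regularV _) a k l b)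
    {x : A} (hx : x ∈ degreeSpace s v ι 1) : compress.{u} ρ x = ρ₁ x := by
  suffices h : degreeSpace s v ι 1 ≤
      LinearMap.ker (compress.{u} ρ - ρ₁.toAlgHom.toLinearMap) from sub_eq_zero.1 (h hx)
  refine Submodule.span_le.2 ?_
  rintro _ ⟨a, k, l, b, hkl, rfl⟩
  obtain rfl : k = l := hι (mul_inv_eq_one.1 hkl)
  refine sub_eq_zero.2 (ext_basisVec fun ⟨r, _⟩ => ?_)
  change ContinuousLinearMap.adjoint (push _ injective_unitFibre)
    (ρ (mon s v a k k b) (push _ injective_unitFibre _)) = ρ₁ (mon s v a k k b) _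
  rw [push_basisVec, hρ, hρ₁]
  by_cases hd : (k : R) ∣ r - b
  · obtain ⟨q, hq⟩ := hd
    obtain rfl : r = b + k * q := by rw [← hq]; ring
    rw [mon_regular_basisVec, mon_regular_basisVec, mul_one, mul_inv_cancel]
    exact adjoint_push_basisVec _ injective_unitFibre (a + k * q, _)
  · rw [mon_regular_basisVec_of_not_dvd ι a k k 1 hd,
      mon_regular_basisVec_of_not_dvd 1 a k k _ hd, map_zero]

/-- The regular representation does not decrease the norm on the span of the elements
`u^a s_k s_l^* u^{-b}`. -/
theorem Relations.norm_le_of_mem_monSpan (h : Relations s v)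
    (hfin : ∀ m : R⁰, Finite (R ⧸ Ideal.span {(m : R)})) (hι : Function.Injective ι)
    (hρ : ∀ a k l b, ρ (mon s v a k l b) = mon (regularS ι) (regularV G) a k l b)
    (hρ₁ : ∀ a k l b, ρ₁ (mon s v a k l b) = mon (regularS 1) (regularV _) a k l b)
    {x : A} (hx : x ∈ monSpan s v) : ‖x‖ ≤ ‖ρ x‖ := by
  refine norm_le_norm_map_of_star_mul_self ρ ?_
  refine norm_le_norm_map_of_graded ρ (degreeSpace s v ι)
    (fun g g' x hx y hy => h.mul_mem_degreeSpace hfin ι hx hy) 1 ?_ (.star_mul_self x)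
    (monSpan_le_iSup_degreeSpace s v ι (h.mul_mem_monSpan hfin (h.star_mem_monSpan hx) hx))
  intro S x hx g hg
  have hmem : star (x g) * x g ∈ degreeSpace s v ι 1 := by
    simpa using h.mul_mem_degreeSpace hfin ι (h.star_mem_degreeSpace ι (hx g)) (hx g)
  have hle : degreeSpace s v ι 1 ≤ Submodule.span ℂ {x | ∃ a k b, x = mon s v a k k b} := by
    refine Submodule.span_mono ?_
    rintro _ ⟨a, k, l, b, hkl, rfl⟩
    obtain rfl : k = l := hι (mul_inv_eq_one.1 hkl)
    exact ⟨a, k, b, rfl⟩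
  have h1 := h.norm_le_of_mem_span_mon_same hfin hρ₁ (.star_mul_self (x g)) (hle hmem)
  -- Multiplying by `star (x g)` shifts the component `x g` to degree one, and compression kills the
  -- rest. Hence `‖x g‖² ≤ ‖x g‖ * ‖ρ (∑ x g)‖`, so the grading constant is `1`.
  have h2 : compress.{u} ρ (star (x g) * ∑ g ∈ S, x g) = ρ₁ (star (x g) * x g) := by
    rw [Finset.mul_sum, map_sum, Finset.sum_eq_single g]
    · exact compress_eq hι hρ hρ₁ hmem
    · intro g' _ hne
      exact compress_eq_zero hρ (fun h3 => hne (inv_mul_eq_one.1 h3).symm)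
        (h.mul_mem_degreeSpace hfin ι (h.star_mem_degreeSpace ι (hx g)) (hx g'))
    · exact fun h3 => absurd hg h3
  rw [← h2, CStarRing.norm_star_mul_self] at h1
  have h3 := h1.trans (norm_compress_mul_le _ _)
  rw [norm_star] at h3
  rw [one_mul]
  rcases (norm_nonneg (x g)).eq_or_lt with h0 | h0
  · rw [← h0]; exact norm_nonneg _
  · exact le_of_mul_le_mul_left h3 h0

end Compression

end AxbAlgebra

/-! ### Compressing to scalars -/

namespace AxbAlgebra

section Scalars

variable {R : Type*} [CommRing R]

/-- An element of `r + (L)` that is fixed by none of finitely many nontrivial affine maps. -/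
theorem exists_not_fixed [IsDomain R] (hR : ¬ IsField R) {n : ℕ} (a b : Fin n → R)
    (k l : Fin n → R⁰) (r : R) (L : R⁰) :
    ∃ c, (L : R) ∣ c - r ∧ ∀ i, ¬ (k i = l i ∧ a i = b i) →
      (l i : R) * (c - a i) ≠ k i * (c - b i) := by
  have hinf : Infinite R := not_finite_iff_infinite.1 fun hf => hR (Finite.isField_of_domain R)
  have hbad : (⋃ i, {t : R | ¬ (k i = l i ∧ a i = b i) ∧
      (l i : R) * (r + L * t - a i) = k i * (r + L * t - b i)}).Finite := by
    -- The fixed point equation is linear in `t`: slope `(l - k) L` is nonzero if `k ≠ l`, and there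
    -- is no solution if `k = l` and `a ≠ b`.
    refine Set.finite_iUnion fun i => Set.Subsingleton.finite ?_
    rintro t ⟨h1, h2⟩ t' ⟨-, h3⟩
    by_cases hkl : k i = l i
    · rw [hkl, mul_right_inj' (nonZeroDivisors.ne_zero (l i).2)] at h2
      exact absurd ⟨hkl, by linear_combination -h2⟩ h1
    · have h4 : ((l i : R) - k i) * L * (t - t') = 0 := by linear_combination h2 - h3
      have h5 : ((l i : R) - k i) ≠ 0 := fun h5 => hkl (Subtype.ext (sub_eq_zero.1 h5).symm)
      exact sub_eq_zero.1 ((mul_eq_zero.1 h4).resolve_left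
        (mul_ne_zero h5 (nonZeroDivisors.ne_zero L.2)))
  obtain ⟨t, ht⟩ := hbad.exists_notMem
  refine ⟨r + L * t, by simp, fun i hi heq => ht (Set.mem_iUnion.2 ⟨i, hi, heq⟩)⟩

/-- For a nonzero nonunit `p`, the product `d * p` cannot divide `d`. Nonzero displacements are thus
detected by some ideal `(m)`. -/
theorem exists_not_dvd [IsDomain R] (hR : ¬ IsField R) {d : R} (hd : d ≠ 0) :
    ∃ m : R⁰, ¬ (m : R) ∣ d := by
  obtain ⟨p, hp, hpu⟩ := Ring.exists_not_isUnit_of_not_isField hR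
  refine ⟨⟨d * p, mem_nonZeroDivisors_of_ne_zero (mul_ne_zero hd hp)⟩, ?_⟩
  rintro ⟨e, he⟩
  refine hpu (IsUnit.of_mul_eq_one e (mul_left_cancel₀ hd ?_))
  rw [mul_one, ← mul_assoc]
  exact he.symm

variable {A : Type*} [CStarAlgebra A] {s : R⁰ → A} {v : R → A}

namespace Relations

/-- The monomial sends `c = b + l q` to `a + k q`. The compression is governed by the displacement
`a - c + k q`: the middle factor vanishes, for `R / (m)` finite, when `m` does not divide it. -/
theorem star_mul_mon_mul (h : Relations s v) (a : R) (k l : R⁰) {b c q : R} (m p : R⁰)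
    (hq : c - b = l * q) :
    star (v c * s (l * m * p)) * mon s v a k l b * (v c * s (l * m * p)) =
      star (s (l * p)) * (star (s m) * v (a - c + k * q) * s m) * s (k * p) := by
  have h1 : s (l * m * p) = s l * (s m * s p) := by rw [h.s_mul, h.s_mul, mul_assoc]
  have h2 : star (s (l * m * p)) = star (s (l * p)) * star (s m) := by
    rw [h.star_s_mul_star_s, mul_left_comm, mul_assoc]
  have h3 : v (a - c + k * q) = v (-c) * v a * v (k * q) := by
    rw [h.v_add, h.v_add]; congr 1; ring
  have h4 : star (s l) * v (-b) * v c * s l = v q := by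
    rw [mul_assoc _ (v (-b)), h.v_add, neg_add_eq_sub, hq, h.star_s_v_s]
  calc _ = star (s (l * m * p)) * v (-c) * v a * s k * (star (s l) * v (-b) * v c * s l) *
        (s m * s p) := by
        rw [star_mul, h.star_v, mon]
        nth_rw 2 [h1]
        simp only [mul_assoc]
    _ = star (s (l * p)) * star (s m) * v (-c) * v a * (s k * v q) * (s m * s p) := by
        rw [h4, h2]; simp only [mul_assoc]
    _ = star (s (l * p)) * star (s m) * v (-c) * v a * v (k * q) * (s k * s m * s p) := by
        rw [h.s_v]; simp only [mul_assoc]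
    _ = _ := by
        rw [h3, h.s_mul k m, mul_comm k m, ← h.s_mul m k, mul_assoc (s m), h.s_mul k p]
        simp only [mul_assoc]

theorem star_mul_mon_mul_eq_zero (h : Relations s v) (a : R) (k l : R⁰) {b c : R} (p : R⁰)
    (hfin : Finite (R ⧸ Ideal.span {(l : R)})) (hd : ¬ (l : R) ∣ c - b) :
    star (v c * s (l * p)) * mon s v a k l b * (v c * s (l * p)) = 0 := by
  have h4 : star (s l) * v (-b) * v c * s l = 0 := by
    rw [mul_assoc _ (v (-b)), h.v_add, neg_add_eq_sub, h.star_s_v_s_eq_zero l hfin hd]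
  calc _ = star (v c * s (l * p)) * v a * s k * (star (s l) * v (-b) * v c * s l) * s p := by
        rw [mon]
        nth_rw 2 [← h.s_mul]
        simp only [mul_assoc]
    _ = 0 := by rw [h4, mul_zero, zero_mul]

variable [IsDomain R]

open scoped Classical in
/-- Finitely many of the elements `u^a s_k s_l^* u^{-b}` can be compressed to scalars. -/
theorem exists_isometry_compress (h : Relations s v) (hR : ¬ IsField R)
    (hfin : ∀ m : R⁰, Finite (R ⧸ Ideal.span {(m : R)})) {n : ℕ} (a b : Fin n → R)
    (k l : Fin n → R⁰) (r : R) :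
    ∃ w : A, star w * w = 1 ∧ ∀ i, star w * mon s v (a i) (k i) (l i) (b i) * w =
      if k i = l i ∧ a i = b i ∧ (l i : R) ∣ r - b i then 1 else 0 := by
  obtain ⟨c, hc, hne⟩ := exists_not_fixed hR a b k l r (∏ i, l i)
  have hm : ∀ i, ∃ m : R⁰, ∀ q, ¬ (k i = l i ∧ a i = b i) → c - b i = l i * q →
      ¬ (m : R) ∣ a i - c + k i * q := by
    intro i
    by_cases hq : ∃ q, ¬ (k i = l i ∧ a i = b i) ∧ c - b i = l i * q
    · obtain ⟨q, hi, hq⟩ := hq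
      have hd : a i - c + k i * q ≠ 0 := fun h0 => hne i hi (by
        rw [hq]; linear_combination (-(l i : R)) * h0)
      obtain ⟨m, hm⟩ := exists_not_dvd hR hd
      refine ⟨m, fun q' _ hq' => ?_⟩
      rw [hq, mul_right_inj' (nonZeroDivisors.ne_zero (l i).2)] at hq'
      rwa [← hq']
    · exact ⟨1, fun q hi h' => absurd ⟨q, hi, h'⟩ hq⟩
  choose m hm using hm
  -- This isometry corresponds to the coset of `c` modulo `∏ l i * m i`, small enough that every
  -- nontrivial monomial defined at `c` moves it off itself.
  refine ⟨v c * s (∏ i, l i * m i), ?_, fun i => ?_⟩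
  · rw [star_mul, mul_assoc, ← mul_assoc (star (v c)), Unitary.star_mul_self_of_mem (h.unitary c),
      one_mul, h.isometry]
  obtain ⟨p, hp⟩ : ∃ p, ∏ i, l i * m i = l i * m i * p :=
    Finset.dvd_prod_of_mem _ (Finset.mem_univ i)
  have hdvd : (l i : R) ∣ c - b i ↔ (l i : R) ∣ r - b i := by
    have h1 : (l i : R) ∣ c - r := by
      refine dvd_trans ?_ hc
      obtain ⟨t, ht⟩ : l i ∣ ∏ i, l i := Finset.dvd_prod_of_mem _ (Finset.mem_univ i)
      exact ⟨t, by rw [ht]; rfl⟩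
    rw [← dvd_add_right (c := r - b i) h1, sub_add_sub_cancel]
  rw [hp]
  by_cases hd : (l i : R) ∣ c - b i
  · obtain ⟨q, hq⟩ := hd
    rw [h.star_mul_mon_mul (a i) (k i) (l i) (m i) p hq]
    by_cases hi : k i = l i ∧ a i = b i
    · rw [if_pos ⟨hi.1, hi.2, hdvd.1 ⟨q, hq⟩⟩]
      have h0 : a i - c + k i * q = 0 := by rw [hi.1, hi.2, ← hq]; ring
      rw [h0, h.v_zero, mul_one, h.isometry, mul_one, hi.1, h.isometry]
    · rw [if_neg fun h' => hi ⟨h'.1, h'.2.1⟩,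
        h.star_s_v_s_eq_zero (m i) (hfin _) (hm i q hi hq), mul_zero, zero_mul]
  · rw [if_neg fun h' => hd (hdvd.2 h'.2.2), mul_assoc (l i),
      h.star_mul_mon_mul_eq_zero _ _ _ _ (hfin _) hd]

end Relations

variable [IsDomain R] {G : Type*} [CommGroup G] {ι : R⁰ →* G}

open scoped Classical in
-- The condition is exactly the one in `exists_isometry_compress`, so compressions compute diagonal
-- coefficients.
theorem inner_mon_regular_basisVec (hι : Function.Injective ι) (a : R) (k l : R⁰) (b r : R)
    (x : G) :
    inner ℂ (basisVec (r, x)) (mon (regularS ι) (regularV G) a k l b (basisVec (r, x))) =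
      if k = l ∧ a = b ∧ (l : R) ∣ r - b then (1 : ℂ) else 0 := by
  by_cases hd : (l : R) ∣ r - b
  · obtain ⟨q, hq⟩ := hd
    obtain rfl : r = b + l * q := by rw [← hq]; ring
    rw [mon_regular_basisVec, inner_basisVec]
    refine if_congr ?_ rfl rfl
    rw [Prod.mk.injEq, ← mul_assoc, eq_comm (a := x), mul_eq_right, mul_inv_eq_one, hι.eq_iff]
    constructor
    · rintro ⟨h1, rfl⟩
      exact ⟨rfl, (add_right_cancel h1).symm, by simp⟩
    · rintro ⟨rfl, rfl, -⟩
      exact ⟨rfl, rfl⟩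
  · rw [mon_regular_basisVec_of_not_dvd ι a k l x hd, inner_zero_right, if_neg fun h => hd h.2.2]

theorem Relations.exists_isometry_compress_monSpan (h : Relations s v) (hR : ¬ IsField R)
    (hfin : ∀ m : R⁰, Finite (R ⧸ Ideal.span {(m : R)})) (hι : Function.Injective ι)
    {ρ : A →⋆ₐ[ℂ] (lp (fun _ : R × G => ℂ) 2 →L[ℂ] lp (fun _ : R × G => ℂ) 2)}
    (hρ : ∀ a k l b, ρ (mon s v a k l b) = mon (regularS ι) (regularV G) a k l b)
    {z : A} (hz : z ∈ monSpan s v) (i : R × G) :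
    ∃ w : A, star w * w = 1 ∧
      star w * z * w = (inner ℂ (basisVec i) (ρ z (basisVec i)) : ℂ) • (1 : A) := by
  classical
  obtain ⟨n, f, g, rfl⟩ := Submodule.mem_span_set'.1 hz
  choose a k l b hg using fun j => (g j).2
  obtain ⟨w, hw, hwi⟩ := h.exists_isometry_compress hR hfin a b k l i.1
  refine ⟨w, hw, ?_⟩
  simp only [hg, map_sum, map_smul, hρ, sum_apply, smul_apply, inner_sum, inner_smul_right,
    Finset.mul_sum, Finset.sum_mul, mul_smul_comm, smul_mul_assoc, hwi, Finset.sum_smul]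
  refine Finset.sum_congr rfl fun j _ => ?_
  rw [inner_mon_regular_basisVec hι]
  split_ifs <;> simp

end Scalars

end AxbAlgebra

/-! ### Simplicity and pure infiniteness -/

namespace RingCStarAlgebra

open AxbAlgebra

variable {R : Type u} [CommRing R]

/-- The span is closed under products and adjoints and contains the generators, hence the image of
every *-polynomial. -/
theorem dense_monSpan (hfin : ∀ m : R⁰, Finite (R ⧸ Ideal.span {(m : R)})) :
    Dense (monSpan (s : R⁰ → RingCStarAlgebra R) v : Set (RingCStarAlgebra R)) := by
  intro x
  refine induction (motive := fun x => x ∈ closure _) x isClosed_closure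
    fun a => subset_closure ?_
  change ofPolyHom a ∈ monSpan s v
  have h : Relations (s : R⁰ → RingCStarAlgebra R) v := relations
  induction a using FreeStarAlgebra.induction with
  | scalar r =>
    have h1 : ofPolyHom (algebraMap ℂ (StarPoly R) r) = r • (1 : RingCStarAlgebra R) := by
      rw [AlgHomClass.commutes, Algebra.algebraMap_eq_smul_one]
    exact h1 ▸ Submodule.smul_mem _ r h.one_mem_monSpan
  | sym x =>
    have hgen : ∀ y : R⁰ ⊕ R,
        ofPolyHom (FreeStarAlgebra.sym (y, false) : StarPoly R) ∈ monSpan s v := by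
      rintro (m | n)
      · exact h.s_mem_monSpan m
      · exact h.v_mem_monSpan n
    rcases x with ⟨y, _ | _⟩
    · exact hgen y
    · have h1 : (FreeStarAlgebra.sym (y, true) : StarPoly R) =
          star (FreeStarAlgebra.sym (y, false) : StarPoly R) :=
        (FreeStarAlgebra.star_sym (y, false)).symm
      have h2 := h.star_mem_monSpan (hgen y)
      exact h1 ▸ (map_star ofPolyHom (FreeStarAlgebra.sym (y, false) : StarPoly R)) ▸ h2
  | mul a b ha hb =>
    exact (map_mul ofPolyHom (a : StarPoly R) b).symm ▸ h.mul_mem_monSpan hfin ha hb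
  | add a b ha hb =>
    exact (map_add ofPolyHom (a : StarPoly R) b).symm ▸ add_mem ha hb

variable [IsDomain R]

/-- The *-homomorphism given by the regular representation on `ℓ²(R × G)`. -/
theorem exists_regular {G : Type u} [CommGroup G] (ι : R⁰ →* G) :
    ∃ ρ : RingCStarAlgebra R →⋆ₐ[ℂ]
        (lp (fun _ : R × G => ℂ) 2 →L[ℂ] lp (fun _ : R × G => ℂ) 2),
      ∀ a k l b, ρ (mon s v a k l b) = mon (regularS ι) (regularV G) a k l b := by
  obtain ⟨ρ, ⟨hs, hv⟩, -⟩ := existsUnique_hom (relations_regular ι)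
  exact ⟨ρ, fun a k l b => by simp only [mon, map_mul, map_star, hs, hv]⟩

theorem nontrivial : Nontrivial (RingCStarAlgebra R) := by
  obtain ⟨ρ, -⟩ := exists_regular (1 : R⁰ →* PUnit.{u + 1})
  refine ⟨⟨0, 1, fun h => ?_⟩⟩
  have h1 := congrArg (fun T => T (basisVec ((0 : R), PUnit.unit))) (congrArg ρ h)
  simp only [map_zero, map_one, zero_apply, one_apply_eq_self] at h1
  have h2 := norm_basisVec ((0 : R), PUnit.unit.{u + 1})
  rw [← h1, norm_zero] at h2
  exact zero_ne_one h2

/-- The embedding of the nonzero elements of `R` into the units of its field of fractions. -/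
theorem exists_injective_units :
    ∃ ι : R⁰ →* (FractionRing R)ˣ, Function.Injective ι := by
  have h0 : ∀ m : R⁰, algebraMap R (FractionRing R) m ≠ 0 := fun m =>
    IsFractionRing.to_map_ne_zero_of_mem_nonZeroDivisors m.2
  refine ⟨{ toFun := fun m => Units.mk0 _ (h0 m), map_one' := ?_, map_mul' := fun k m => ?_ },
    fun k m h => ?_⟩
  · ext; simp
  · ext; simp
  · exact Subtype.ext (IsFractionRing.injective R (FractionRing R) (congrArg Units.val h))

theorem exists_mul_mul_eq_one (hR : ¬ IsField R)
    (hfin : ∀ m : R⁰, Finite (R ⧸ Ideal.span {(m : R)})) {x : RingCStarAlgebra R} (hx : x ≠ 0) :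
    ∃ a b, a * x * b = 1 := by
  obtain ⟨ι, hι⟩ := exists_injective_units (R := R)
  obtain ⟨ρ, hρ⟩ := exists_regular ι
  obtain ⟨ρ₁, hρ₁⟩ := exists_regular (1 : R⁰ →* PUnit.{u + 1})
  have hrel : Relations (s : R⁰ → RingCStarAlgebra R) v := relations
  have hcont : Continuous ρ := AddMonoidHomClass.continuous_of_bound ρ 1 fun y => by
    rw [one_mul]
    exact NonUnitalStarAlgHom.norm_apply_le ρ y
  -- The norm inequality is a closed condition, so it passes from the dense span to the whole
  -- algebra.
  have hfaithful : ‖x‖ ≤ ‖ρ x‖ := by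
    refine (dense_monSpan hfin).induction
      (P := fun x => ‖x‖ ≤ ‖ρ x‖) (fun y hy => ?_) ?_ x
    · exact hrel.norm_le_of_mem_monSpan hfin hι hρ hρ₁ hy
    · exact isClosed_le continuous_norm (continuous_norm.comp hcont)
  obtain ⟨i, hi⟩ : ∃ i, ρ x (basisVec i) ≠ 0 := by
    by_contra! h0
    have h1 : ρ x = 0 := ext_basisVec fun i => by simp [h0]
    rw [h1, norm_zero] at hfaithful
    exact hx (norm_le_zero_iff.1 hfaithful)
  set c : ℝ := ‖ρ x (basisVec i)‖ ^ 2 with hc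
  have hc0 : 0 < c := by positivity
  -- The tolerance `c / 2` is spent twice, on the compression and on the diagonal coefficient. The
  -- total error is below `c`, so dividing by `c` lands within distance one of `1`.
  obtain ⟨z, hz, hzc⟩ : ∃ z ∈ monSpan (s : R⁰ → RingCStarAlgebra R) v,
      ‖star x * x - z‖ < c / 2 := by
    obtain ⟨z, hz, hd⟩ := Metric.dense_iff.1 (dense_monSpan hfin) (star x * x) (c / 2) (by positivity)
    exact ⟨z, hd, by rw [← dist_eq_norm, dist_comm]; exact hz⟩
  obtain ⟨w, hw, hwz⟩ := hrel.exists_isometry_compress_monSpan hR hfin hι hρ hz i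
  have hin : inner ℂ (basisVec i) (ρ (star x * x) (basisVec i)) = (c : ℂ) := by
    rw [map_mul, map_star, mul_apply_eq_comp, ContinuousLinearMap.star_eq_adjoint,
      ContinuousLinearMap.adjoint_inner_right, inner_self_eq_norm_sq_to_K, hc]
    simp
  have hwn : ‖w‖ ≤ 1 := StarPoly.norm_le_one_of_isometry hw
  have h1 : ‖star w * (star x * x - z) * w‖ < c / 2 := by
    refine lt_of_le_of_lt ?_ hzc
    refine (norm_mul_le _ _).trans ((mul_le_of_le_one_right (norm_nonneg _) hwn).trans ?_)
    refine (norm_mul_le _ _).trans (mul_le_of_le_one_left (norm_nonneg _) ?_)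
    rwa [norm_star]
  have h2 : ‖inner ℂ (basisVec i) (ρ (star x * x - z) (basisVec i))‖ < c / 2 := by
    refine lt_of_le_of_lt ?_ hzc
    refine (norm_inner_le_norm _ _).trans ?_
    rw [norm_basisVec, one_mul]
    refine (ContinuousLinearMap.le_opNorm _ _).trans ?_
    rw [norm_basisVec, mul_one]
    exact NonUnitalStarAlgHom.norm_apply_le ρ _
  have h3 : ‖(c : ℂ) • (1 : RingCStarAlgebra R) - star w * (star x * x) * w‖ < c := by
    have h4 : (c : ℂ) • (1 : RingCStarAlgebra R) - star w * (star x * x) * w =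
        (inner ℂ (basisVec i) (ρ (star x * x - z) (basisVec i)) : ℂ) • (1 : RingCStarAlgebra R) -
          star w * (star x * x - z) * w := by
      rw [mul_sub, sub_mul, hwz, map_sub, sub_apply, inner_sub_right, sub_smul, hin]
      abel
    rw [h4]
    refine (norm_sub_le _ _).trans_lt ?_
    rw [norm_smul]
    have h5 := mul_le_of_le_one_right (norm_nonneg
      (inner ℂ (basisVec i) (ρ (star x * x - z) (basisVec i))))
      (StarPoly.norm_one_le (B := RingCStarAlgebra R))
    linarith
  have hcne : (c : ℂ) ≠ 0 := by exact_mod_cast hc0.ne'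
  have hu : IsUnit ((c : ℂ)⁻¹ • (star w * (star x * x) * w)) := by
    have h6 : (c : ℂ)⁻¹ • (star w * (star x * x) * w) =
        1 - (c : ℂ)⁻¹ • ((c : ℂ) • (1 : RingCStarAlgebra R) - star w * (star x * x) * w) := by
      rw [smul_sub, smul_smul, inv_mul_cancel₀ hcne, one_smul, sub_sub_cancel]
    rw [h6]
    refine isUnit_one_sub_of_norm_lt_one ?_
    rw [norm_smul, norm_inv, Complex.norm_real, Real.norm_of_nonneg hc0.le, inv_mul_lt_iff₀ hc0,
      mul_one]
    exact h3
  obtain ⟨y, hy⟩ := hu.exists_left_inv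
  refine ⟨y * ((c : ℂ)⁻¹ • (star w * star x)), w, ?_⟩
  rw [← hy]
  simp only [mul_smul_comm, smul_mul_assoc, mul_assoc]

end RingCStarAlgebra

/-- For an integral domain `R` that is not a field and whose nonzero principal ideals have finite
index, the universal C*-algebra `𝔄[R]` is simple and purely infinite. -/
theorem mainTheorem1 {R : Type u} [CommRing R] [IsDomain R] (hR : ¬ IsField R)
    (hfin : ∀ m : R, m ≠ 0 → Finite (R ⧸ Ideal.span {m})) :
    IsSimpleCStarAlgebra (RingCStarAlgebra R) ∧
      IsPurelyInfiniteCStarAlgebra (RingCStarAlgebra R) := by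
  have hfin' : ∀ m : R⁰, Finite (R ⧸ Ideal.span {(m : R)}) := fun m =>
    hfin m (nonZeroDivisors.ne_zero m.2)
  have key : ∀ x : RingCStarAlgebra R, x ≠ 0 → ∃ a b, a * x * b = 1 := fun x hx =>
    RingCStarAlgebra.exists_mul_mul_eq_one hR hfin' hx
  have : Nontrivial (RingCStarAlgebra R) := RingCStarAlgebra.nontrivial
  refine ⟨⟨this, fun I _ => ?_⟩, ⟨fun φ => ?_⟩, key⟩
  · by_cases hI : ∃ x ∈ I, x ≠ 0
    · obtain ⟨x, hxI, hx⟩ := hI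
      obtain ⟨a, b, hab⟩ := key x hx
      refine Or.inr (I.one_mem_iff.1 ?_)
      rw [← hab]
      exact I.mul_mem_right _ _ (I.mul_mem_left _ _ hxI)
    · push Not at hI
      exact Or.inl (eq_bot_iff.2 fun x hx => hI x hx)
  -- In a commutative algebra `s_m^* u^1 s_m` would equal the unitary `u^1`, yet it is zero when `m`
  -- does not divide `1`.
  · have hcomm : ∀ x y : RingCStarAlgebra R, x * y = y * x := fun x y =>
      φ.injective (by rw [map_mul, map_mul, mul_comm])
    obtain ⟨m, hm⟩ := AxbAlgebra.exists_not_dvd hR (one_ne_zero (α := R))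
    have hrel := RingCStarAlgebra.relations (R := R)
    have h0 := hrel.star_s_v_s_eq_zero m (hfin' m) hm
    rw [mul_assoc, hcomm (RingCStarAlgebra.v 1), ← mul_assoc, hrel.isometry, one_mul] at h0
    have h1 := Unitary.star_mul_self_of_mem (hrel.unitary 1)
    rw [h0, mul_zero] at h1
    exact zero_ne_one h1
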